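/- A prosumer has $K$ flexible loads and an EV over stages $t=0,\dots,T-1$. At stage $t$ the remaining charging demand $y_t\ge 0$ and the renewable generation $r_t$ are observed, where $r_0,r_1,\dots$ are independent integrable random variables. The prosumer chooses the charging $v_t\in[0,\min\{\bar v,y_t\}]$ and the consumption $d_t\in\prod_{i=1}^K[0,\bar d^{(i)}]$, and $y_{t+1}=y_t-v_t$ (with $\bar v,\bar d^{(i)}\ge 0$). The stage reward is $\sum_i U_t^{(i)}(d_t^{(i)})-P_t(z_t)$ with $z_t=v_t+\sum_i d_t^{(i)}-r_t$ and $P_t(z)=\pi_t^+\max\{z,0\}-\pi_t^-\max\{-z,0\}$; the terminal reward is $-\gamma y_T$. The $U_t^{(i)}$ are strictly concave and continuously differentiable on $[0,\bar d^{(i)}]$ with marginal utility $L_t^{(i)}$, and $l_t^{(i)}$ is the inverse of $L_t^{(i)}$ truncated to $[0,\bar d^{(i)}]$. The deterministic prices (for instance on- /off-peak time-of-use prices) satisfy $\pi_t^-\le\pi_t^+\le\gamma$ for all $t<T$. Let $V_T(y,r)=-\gamma y$ and let $V_t(y,r)$ be the maximum over feasible $(v,d)$ of the stage reward plus $\bar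 V_{t+1}(y-v)$, where $\bar V_t(y)=\mathbb E[V_t(y,r_t)]$; let $h_t(y)$ be the set of all $g$ with $\bar V_t(y')\le\bar V_t(y)+g(y'-y)$ for all $y'\ge 0$ (the subdifferential of the concave function $\bar V_t$ on $[0,\infty)$). **Theorem 1.** The expectations $\bar V_t(y)$ ($t\le T$, $y\ge0$), and the expected total reward of each admissible (measurable and feasible) Markov policy from each initial demand $y_0\ge0$, are finite. There are thresholds $\tau_t,\delta_t\in[0,(T-t-1)\bar v]$, $\delta_t\le\tau_t$, with $-\pi_t^+\in h_{t+1}(\tau_t)$ and $-\pi_t^-\in h_{t+1}(\delta_t)$ for all $t<T$. For any $\tau_t,\delta_t\ge0$ satisfying these two inclusions (and $\delta_t\le\tau_t$, which is automatic if $\pi_t^-<\pi_t^+$) put $$v_t^+(y)=\min\{\bar v,\max\{y-\tau_t,0\}\},\quad v_t^-(y)=\min\{\bar v,\max\{y-\delta_t,0\}\},\quad \Delta_t^\pm(y)=v_t^\pm(y)+\sum_i l_t^{(i)}(\pi_t^\pm).$$ Then $\Delta_t^+(y)\le\Delta_t^-(y)$ for all $t<T$, $y\ge0$, and there is an admissible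 policy $(v_t^*,d_t^*)(y,r)$ such that, for all $t<T$, $y\ge 0$ and $r$: 1. (net consumption) if $r<\Delta_t^+(y)$, then $v_t^*=v_t^+(y)$ and $d_t^{(i)*}=l_t^{(i)}(\pi_t^+)$; 2. (net production) if $r>\Delta_t^-(y)$, then $v_t^*=v_t^-(y)$ and $d_t^{(i)*}=l_t^{(i)}(\pi_t^-)$; 3. (net zero) if $\Delta_t^+(y)\le r\le\Delta_t^-(y)$, then for some $\nu\in[\pi_t^-,\pi_t^+]$ and some $\theta\ge0$ with $-\nu\in h_{t+1}(\theta)$: $v_t^*=\min\{\bar v,\max\{y-\theta,0\}\}$, $d_t^{(i)*}=l_t^{(i)}(\nu)$ and $v_t^*+\sum_i d_t^{(i)*}=r$. Every policy with properties 1–3 attains the maximum in the Bellman equation in every state with $y\ge0$, and its consumption is the only optimal one there; in the net-zero zone its $v_t^*$ and all $d_t^{(i)*}$ are monotone increasing (nondecreasing) in $r$. If it is measurable, it maximizes the expected total reward among all admissible policies, for every initial demand $y_0\ge0$, and its expected total reward is $\bar V_0(y_0)$. -/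

import Mathlib

open MeasureTheory ProbabilityTheory Set

noncomputable section

/-- Data of a prosumer with `K` flexible loads and an EV, over the stages `0, …, T - 1`, under a
net energy metering tariff with time-varying prices (a time-of-use tariff is the special case in
which the prices take one on-peak and one off-peak value). -/
structure Prosumer (K : ℕ) where
  /-- horizon -/
  T : ℕ
  /-- maximal EV charging per stage -/
  vbar : ℝ
  /-- maximal consumption of each load per stage -/
  dbar : Fin K → ℝ
  /-- utility `U_t^{(i)}` of consumption of load `i` at stage `t` -/
  U : ℕ → Fin K → ℝ → ℝ
  /-- retail (buying) price `π_t^+` -/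
  πp : ℕ → ℝ
  /-- compensation (selling) price `π_t^-` -/
  πm : ℕ → ℝ
  /-- penalty for each unit of charging demand not met at the deadline -/
  γ : ℝ

/-- A decision: the EV charging `v` and the consumption vector `d`. -/
abbrev Decision (K : ℕ) := ℝ × (Fin K → ℝ)

/-- A (deterministic, Markov) policy: it selects, at each stage `t`, a decision from the state,
that is, from the remaining charging demand `y` and the renewable generation `r`. -/
abbrev Policy (K : ℕ) := ℕ → ℝ → ℝ → Decision K

namespace Prosumer

variable {K : ℕ} (M : Prosumer K)

/-- Standing conventions: nonnegative limits, and utilities that are strictly concave and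
continuously differentiable on the consumption ranges. -/
structure Regular : Prop where
  vbar_nonneg : 0 ≤ M.vbar
  dbar_nonneg : ∀ i, 0 ≤ M.dbar i
  contDiffOn : ∀ t < M.T, ∀ i, ContDiffOn ℝ 1 (M.U t i) (Icc 0 (M.dbar i))
  strictConcaveOn : ∀ t < M.T, ∀ i, StrictConcaveOn ℝ (Icc 0 (M.dbar i)) (M.U t i)

/-- Price assumption: the selling price does not exceed the buying price, which does not exceed
the penalty. -/
def PriceAssumption : Prop :=
  ∀ t < M.T, M.πm t ≤ M.πp t ∧ M.πp t ≤ M.γ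

/-- Payment for the net consumption `z`: bought at `π_t^+` if `z ≥ 0`, sold at `π_t^-` if not. -/
def payment (t : ℕ) (z : ℝ) : ℝ :=
  M.πp t * max z 0 - M.πm t * max (-z) 0

/-- Total consumption of EV and loads. -/
def totalLoad (u : Decision K) : ℝ := u.1 + ∑ i, u.2 i

/-- Stage reward: utility of consumption minus payment. -/
def stageReward (t : ℕ) (r : ℝ) (u : Decision K) : ℝ :=
  (∑ i, M.U t i (u.2 i)) - M.payment t (totalLoad u - r)

/-- Feasible decisions when the remaining charging demand is `y`. -/
def feasible (y : ℝ) : Set (Decision K) :=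
  {u | u.1 ∈ Icc 0 (min M.vbar y) ∧ ∀ i, u.2 i ∈ Icc 0 (M.dbar i)}

section DynamicProgram

variable {Ω : Type*} [MeasurableSpace Ω] (P : Measure Ω) (R : ℕ → Ω → ℝ)

/-- Optimal value with `n` stages to go (at stage `T - n`), by backward recursion. -/
def valueToGo : ℕ → ℝ → ℝ → ℝ
  | 0, y, _ => -M.γ * y
  | n + 1, y, r =>
      sSup ((fun u : Decision K =>
        M.stageReward (M.T - (n + 1)) r u + ∫ ω, valueToGo n (y - u.1) (R (M.T - n) ω) ∂P) ''
          M.feasible y)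

/-- The value function `V_t (y, r)` of the dynamic program, for `t ≤ T`. -/
def value (t : ℕ) (y r : ℝ) : ℝ := M.valueToGo P R (M.T - t) y r

/-- The expected value function `y ↦ E[V_t (y, r_t)]`. -/
def expectedValue (t : ℕ) (y : ℝ) : ℝ := ∫ ω, M.value P R t y (R t ω) ∂P

/-- Objective of the Bellman equation at stage `t` and state `(y, r)`. -/
def bellmanObjective (t : ℕ) (y r : ℝ) (u : Decision K) : ℝ :=
  M.stageReward t r u + M.expectedValue P R (t + 1) (y - u.1)

/-- Terminal condition of the dynamic program. -/
theorem value_terminal (y r : ℝ) : M.value P R M.T y r = -M.γ * y := by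
  simp [value, valueToGo]

/-- The Bellman equation. -/
theorem value_bellman (t : ℕ) (ht : t < M.T) (y r : ℝ) :
    M.value P R t y r = sSup (M.bellmanObjective P R t y r '' M.feasible y) := by
  obtain ⟨n, hn⟩ : ∃ n, M.T - t = n + 1 := ⟨M.T - t - 1, by omega⟩
  have h1 : M.T - (n + 1) = t := by omega
  have h2 : M.T - n = t + 1 := by omega
  have h3 : M.T - (t + 1) = n := by omega
  rw [value, hn, valueToGo, h1, h2]
  unfold bellmanObjective expectedValue value
  rw [h3]

/-- A decision is optimal at stage `t` in state `(y, r)` if it is feasible and attains the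
maximum in the Bellman equation. -/
def IsOptimalDecision (t : ℕ) (y r : ℝ) (u : Decision K) : Prop :=
  u ∈ M.feasible y ∧ IsMaxOn (M.bellmanObjective P R t y r) (M.feasible y) u

/-- The subdifferential `h_t (y)` at `y ≥ 0` of the concave function `E[V_t (·, r_t)]`, whose
domain is `[0, ∞)`. -/
def subdiff (t : ℕ) (y : ℝ) : Set ℝ :=
  {g | ∀ y', 0 ≤ y' → M.expectedValue P R t y' ≤ M.expectedValue P R t y + g * (y' - y)}

/-- Marginal utility `L_t^{(i)}` on `[0, dbar_i]` (one-sided derivatives at the end points). -/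
def marginalUtility (t : ℕ) (i : Fin K) (x : ℝ) : ℝ :=
  derivWithin (M.U t i) (Icc 0 (M.dbar i)) x

open Classical in
/-- Inverse marginal utility `l_t^{(i)}`, truncated to the consumption range `[0, dbar_i]`. -/
def invMarginal (t : ℕ) (p : ℝ) : Fin K → ℝ := fun i =>
  if M.marginalUtility t i 0 ≤ p then 0
  else if p ≤ M.marginalUtility t i (M.dbar i) then M.dbar i
  else Function.invFunOn (M.marginalUtility t i) (Icc 0 (M.dbar i)) p

/-- Charging rule with threshold `θ`: charge, at most `vbar`, down to the remaining demand `θ`. -/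
def chargeTo (θ y : ℝ) : ℝ := min M.vbar (max (y - θ) 0)

/-- Renewable threshold for the price `p` and the charging threshold `θ`. It is `Δ_t^+ (y)` for
`p = π_t^+`, `θ = τ_t`, and `Δ_t^- (y)` for `p = π_t^-`, `θ = δ_t`. -/
def renewableThreshold (t : ℕ) (p θ y : ℝ) : ℝ :=
  M.chargeTo θ y + ∑ i, M.invMarginal t p i

/-- `τ` and `δ` are charging thresholds: `-π_t^+ ∈ h_{t+1} (τ_t)` and `-π_t^- ∈ h_{t+1} (δ_t)`.
If `π_t^- < π_t^+` then `δ_t ≤ τ_t` is automatic; if the two prices are equal, they are to be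
chosen in this order. -/
def IsThresholds (τ δ : ℕ → ℝ) : Prop :=
  ∀ t < M.T, 0 ≤ τ t ∧ 0 ≤ δ t ∧
    -M.πp t ∈ M.subdiff P R (t + 1) (τ t) ∧
    -M.πm t ∈ M.subdiff P R (t + 1) (δ t) ∧
    (M.πm t = M.πp t → δ t ≤ τ t)

/-- The net-zero decision rule: for a common marginal price `ν` between `π_t^-` and `π_t^+` and a
charging threshold at this price, EV and loads together use exactly the renewable generation. -/
def NetZeroRule (t : ℕ) (y r : ℝ) (u : Decision K) : Prop :=
  ∃ ν ∈ Icc (M.πm t) (M.πp t), ∃ θ, 0 ≤ θ ∧ -ν ∈ M.subdiff P R (t + 1) θ ∧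
    u = (M.chargeTo θ y, M.invMarginal t ν) ∧ totalLoad u = r

/-- The three-zone threshold structure of a policy: net consumption, net production, net zero. -/
def HasThresholdStructure (τ δ : ℕ → ℝ) (μ : Policy K) : Prop :=
  ∀ t < M.T, ∀ y, 0 ≤ y → ∀ r,
    (r < M.renewableThreshold t (M.πp t) (τ t) y →
      μ t y r = (M.chargeTo (τ t) y, M.invMarginal t (M.πp t))) ∧
    (M.renewableThreshold t (M.πm t) (δ t) y < r →
      μ t y r = (M.chargeTo (δ t) y, M.invMarginal t (M.πm t))) ∧
    (r ∈ Icc (M.renewableThreshold t (M.πp t) (τ t) y)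
        (M.renewableThreshold t (M.πm t) (δ t) y) →
      M.NetZeroRule P R t y r (μ t y r))

/-- Admissible policies: measurable, with feasible decisions. -/
def Admissible (μ : Policy K) : Prop :=
  (∀ t < M.T, Measurable fun s : ℝ × ℝ => μ t s.1 s.2) ∧
    ∀ t < M.T, ∀ y, 0 ≤ y → ∀ r, μ t y r ∈ M.feasible y

/-- Remaining charging demand at stage `t` under the policy `μ`, starting from `y₀`. -/
def demand (μ : Policy K) (y₀ : ℝ) : ℕ → Ω → ℝ
  | 0, _ => y₀
  | t + 1, ω => demand μ y₀ t ω - (μ t (demand μ y₀ t ω) (R t ω)).1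

/-- Total reward along a trajectory, including the penalty for the unmet charging demand. -/
def totalReward (μ : Policy K) (y₀ : ℝ) (ω : Ω) : ℝ :=
  (∑ t ∈ Finset.range M.T,
    M.stageReward t (R t ω) (μ t (demand R μ y₀ t ω) (R t ω))) -
    M.γ * demand R μ y₀ M.T ω

/-- A policy solves the stochastic dynamic program: it is admissible and has the largest expected
total reward among the admissible policies, for every initial charging demand. -/
def IsOptimalPolicy (μ : Policy K) : Prop :=
  M.Admissible μ ∧ ∀ y₀, 0 ≤ y₀ → ∀ μ', M.Admissible μ' →
    ∫ ω, M.totalReward R μ' y₀ ω ∂P ≤ ∫ ω, M.totalReward R μ y₀ ω ∂P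

end DynamicProgram

end Prosumer

end

namespace Prosumer

variable {K : ℕ} {M : Prosumer K} {t : ℕ}

/-! ### Utilities and their truncated inverse marginals -/

/-! The argument is price duality. Since `π_t^- ≤ π_t^+`, the payment is the maximum of two linear
functions, so `ν z` bounds it from below for every `ν` between the two prices. Replacing the payment
by `ν z` separates the Bellman objective: each load maximizes `U - ν d`, giving `l(ν)`, and charging
maximizes `V̄_{t+1}(y - v) - ν v`, giving the charge down to some `θ` with `-ν ∈ h_{t+1}(θ)`. The
relaxation is exact if `ν` supports the payment at the resulting net consumption: `π_t^+` if that is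
positive, `π_t^-` if negative, any `ν` if zero. This is `rule_isOptimal`; strict concavity makes the
consumption unique.

The charging step needs `V̄_t` concave. `RegularValue` carries this backward in time, with Lipschitz
continuity (for integrability) and a slope of at most `-γ` beyond the demand that can still be
charged (for bounded thresholds).

In the net-zero zone, `ν` and `θ` must be selected measurably. The graph of the subdifferential is a
continuous monotone curve (`exists_price_curve`), along which the total load decreases continuously
from `Δ_t^-` to `Δ_t^+`; the first point where it falls to `r` is measurable.

Finally, the demand at stage `t` depends only on earlier generation, hence is independent of `r_t`,
and the Bellman inequalities telescope. -/

lemma utility_le_tangent (hM : M.Regular) (ht : t < M.T) (i : Fin K) {x x' : ℝ}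
    (hx : x ∈ Icc 0 (M.dbar i)) (hx' : x' ∈ Icc 0 (M.dbar i)) :
    M.U t i x' ≤ M.U t i x + M.marginalUtility t i x * (x' - x) := by
  have hc := (hM.strictConcaveOn t ht i).concaveOn
  have hd : DifferentiableWithinAt ℝ (M.U t i) (Icc 0 (M.dbar i)) x :=
    (hM.contDiffOn t ht i).differentiableOn (by norm_num) x hx
  unfold marginalUtility
  rcases lt_trichotomy x x' with h | rfl | h
  · have := hc.slope_le_derivWithin hx hx' h hd
    rw [slope_def_field, div_le_iff₀ (by linarith)] at this
    linarith
  · simp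
  · have := hc.derivWithin_le_slope hx' hx h hd
    rw [slope_def_field, le_div_iff₀ (by linarith)] at this
    linarith

lemma continuousOn_marginalUtility (hM : M.Regular) (ht : t < M.T) (i : Fin K) :
    ContinuousOn (M.marginalUtility t i) (Icc 0 (M.dbar i)) := by
  -- A one-point range has no unique derivative, but any function on it is continuous.
  rcases (hM.dbar_nonneg i).eq_or_lt with h | h
  · rw [← h, Icc_self]
    exact continuousOn_singleton _ _
  · exact (hM.contDiffOn t ht i).continuousOn_derivWithin (uniqueDiffOn_Icc h) le_rfl

/-- The three branches of the truncated inverse are the first-order conditions at `0`, at `dbar` and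
at a point of marginal utility `p`; the tangent inequality makes each sufficient for a maximum. -/
lemma invMarginal_spec (hM : M.Regular) (ht : t < M.T) (p : ℝ) (i : Fin K) :
    M.invMarginal t p i ∈ Icc 0 (M.dbar i) ∧ ∀ x ∈ Icc 0 (M.dbar i),
      M.U t i x - p * x ≤ M.U t i (M.invMarginal t p i) - p * M.invMarginal t p i := by
  have hb := hM.dbar_nonneg i
  unfold invMarginal
  split_ifs with h1 h2
  · refine ⟨⟨le_rfl, hb⟩, fun x hx => ?_⟩
    have := utility_le_tangent hM ht i ⟨le_rfl, hb⟩ hx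
    nlinarith [mul_nonneg (sub_nonneg.2 h1) hx.1]
  · refine ⟨⟨hb, le_rfl⟩, fun x hx => ?_⟩
    have := utility_le_tangent hM ht i ⟨hb, le_rfl⟩ hx
    nlinarith [mul_nonneg (sub_nonneg.2 h2) (sub_nonneg.2 hx.2)]
  · have hex : ∃ x ∈ Icc 0 (M.dbar i), M.marginalUtility t i x = p :=
      intermediate_value_Icc' hb (continuousOn_marginalUtility hM ht i)
        ⟨(not_le.1 h2).le, (not_le.1 h1).le⟩
    have hm := Function.invFunOn_mem hex
    refine ⟨hm, fun x hx => ?_⟩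
    have := utility_le_tangent hM ht i hm hx
    rw [Function.invFunOn_eq hex] at this
    linarith

lemma invMarginal_mem (hM : M.Regular) (ht : t < M.T) (p : ℝ) (i : Fin K) :
    M.invMarginal t p i ∈ Icc 0 (M.dbar i) := (invMarginal_spec hM ht p i).1

lemma surplus_le_invMarginal (hM : M.Regular) (ht : t < M.T) (p : ℝ) (i : Fin K) {x : ℝ}
    (hx : x ∈ Icc 0 (M.dbar i)) :
    M.U t i x - p * x ≤ M.U t i (M.invMarginal t p i) - p * M.invMarginal t p i :=
  (invMarginal_spec hM ht p i).2 x hx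

/-- Otherwise, by strict concavity, the midpoint of two distinct maximizers would have a larger
surplus. -/
lemma eq_invMarginal (hM : M.Regular) (ht : t < M.T) (p : ℝ) (i : Fin K) {x : ℝ}
    (hx : x ∈ Icc 0 (M.dbar i))
    (h : M.U t i (M.invMarginal t p i) - p * M.invMarginal t p i ≤ M.U t i x - p * x) :
    x = M.invMarginal t p i := by
  by_contra hne
  have hl := invMarginal_mem hM ht p i
  have h2 : (0 : ℝ) < 1 / 2 := by norm_num
  have hs := (hM.strictConcaveOn t ht i).2 hx hl hne h2 h2 (by norm_num)
  have hm := surplus_le_invMarginal hM ht p i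
    ((convex_Icc 0 (M.dbar i)) hx hl h2.le h2.le (by norm_num))
  simp only [smul_eq_mul] at hs hm
  linarith

/-- Revealed preference: add the optimality inequalities at the two prices. -/
lemma invMarginal_antitone (hM : M.Regular) (ht : t < M.T) (i : Fin K) :
    Antitone fun p => M.invMarginal t p i := by
  intro p q hpq
  rcases hpq.eq_or_lt with rfl | hlt
  · exact le_rfl
  have h1 := surplus_le_invMarginal hM ht p i (invMarginal_mem hM ht q i)
  have h2 := surplus_le_invMarginal hM ht q i (invMarginal_mem hM ht p i)
  show M.invMarginal t q i ≤ M.invMarginal t p i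
  by_contra! hc
  nlinarith [mul_pos (sub_pos.2 hlt) (sub_pos.2 hc)]

/-- A monotone map onto an interval is continuous. Each `x` is attained, at the price equal to its
marginal utility. -/
lemma continuous_invMarginal (hM : M.Regular) (ht : t < M.T) (i : Fin K) :
    Continuous fun p => M.invMarginal t p i := by
  have hmono : Monotone fun q : ℝ =>
      (⟨M.invMarginal t (-q) i, invMarginal_mem hM ht (-q) i⟩ : Icc 0 (M.dbar i)) :=
    fun p q hpq => Subtype.mk_le_mk.2 (invMarginal_antitone hM ht i (neg_le_neg hpq))
  have hsurj : Function.Surjective fun q : ℝ =>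
      (⟨M.invMarginal t (-q) i, invMarginal_mem hM ht (-q) i⟩ : Icc 0 (M.dbar i)) := by
    rintro ⟨x, hx⟩
    refine ⟨-M.marginalUtility t i x, Subtype.ext ?_⟩
    simp only [neg_neg]
    refine (eq_invMarginal hM ht _ i hx ?_).symm
    have := utility_le_tangent hM ht i hx (invMarginal_mem hM ht (M.marginalUtility t i x) i)
    linarith
  have := continuous_subtype_val.comp ((hmono.continuous_of_surjective hsurj).comp continuous_neg)
  simpa [Function.comp_def] using this

/-! ### Payment -/

lemma payment_eq_max (h : M.πm t ≤ M.πp t) (z : ℝ) :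
    M.payment t z = max (M.πp t * z) (M.πm t * z) := by
  unfold payment
  rcases le_total 0 z with hz | hz
  · rw [max_eq_left hz, max_eq_right (by linarith), max_eq_left (by gcongr)]
    ring
  · rw [max_eq_right hz, max_eq_left (by linarith), max_eq_right (by nlinarith)]
    ring

/-- Weak duality, the source of the relaxation in `rule_isOptimal`. -/
lemma mul_le_payment {ν : ℝ} (hν : ν ∈ Icc (M.πm t) (M.πp t)) (z : ℝ) :
    ν * z ≤ M.payment t z := by
  rw [payment_eq_max (hν.1.trans hν.2)]
  rcases le_total 0 z with hz | hz
  · exact le_max_of_le_left (mul_le_mul_of_nonneg_right hν.2 hz)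
  · exact le_max_of_le_right (mul_le_mul_of_nonpos_right hν.1 hz)

lemma payment_of_nonneg {z : ℝ} (hz : 0 ≤ z) : M.payment t z = M.πp t * z := by
  simp [payment, hz]

lemma payment_of_nonpos {z : ℝ} (hz : z ≤ 0) : M.payment t z = M.πm t * z := by
  simp [payment, hz]

lemma convexOn_payment (h : M.πm t ≤ M.πp t) : ConvexOn ℝ univ (M.payment t) := by
  have : M.payment t = (fun z => M.πp t * z) ⊔ fun z => M.πm t * z :=
    funext fun z => payment_eq_max h z
  rw [this]
  refine ConvexOn.sup ?_ ?_ <;>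
  exact ⟨convex_univ, fun x _ y _ a b _ _ _ => by simp only [smul_eq_mul]; linarith⟩

lemma payment_lipschitz (h : M.πm t ≤ M.πp t) (z z' : ℝ) :
    |M.payment t z - M.payment t z'| ≤ (|M.πp t| + |M.πm t|) * |z - z'| := by
  rw [payment_eq_max h, payment_eq_max h]
  refine (abs_max_sub_max_le_max _ _ _ _).trans ?_
  rw [← mul_sub, ← mul_sub, abs_mul, abs_mul]
  refine max_le ?_ ?_ <;> gcongr <;> simp

lemma continuous_payment : Continuous (M.payment t) := by
  unfold payment
  fun_prop

end Prosumer

namespace Prosumer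

variable {K : ℕ} {M : Prosumer K} {t : ℕ}
  {Ω : Type*} [MeasurableSpace Ω] {P : Measure Ω} {R : ℕ → Ω → ℝ}

/-! ### Feasible decisions and the Bellman objective -/

lemma feasible_eq_prod (M : Prosumer K) (y : ℝ) :
    M.feasible y = Icc 0 (min M.vbar y) ×ˢ univ.pi fun i => Icc 0 (M.dbar i) := by
  ext u
  simp only [feasible, mem_ofPred_eq, mem_prod, mem_univ_pi]

lemma isCompact_feasible (M : Prosumer K) (y : ℝ) : IsCompact (M.feasible y) := by
  rw [feasible_eq_prod]
  exact isCompact_Icc.prod (isCompact_univ_pi fun _ => isCompact_Icc)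

lemma feasible_nonempty (hM : M.Regular) {y : ℝ} (hy : 0 ≤ y) : (M.feasible y).Nonempty :=
  ⟨0, ⟨le_rfl, le_min hM.vbar_nonneg hy⟩, fun i => ⟨le_rfl, hM.dbar_nonneg i⟩⟩

lemma feasible_combo {y₁ y₂ a b : ℝ} {u₁ u₂ : Decision K} (h₁ : u₁ ∈ M.feasible y₁)
    (h₂ : u₂ ∈ M.feasible y₂) (ha : 0 ≤ a) (hb : 0 ≤ b) (hab : a + b = 1) :
    a • u₁ + b • u₂ ∈ M.feasible (a * y₁ + b * y₂) := by
  obtain ⟨⟨hv₁, hv₁'⟩, hd₁⟩ := h₁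
  obtain ⟨⟨hv₂, hv₂'⟩, hd₂⟩ := h₂
  refine ⟨⟨?_, le_min ?_ ?_⟩, fun i => convex_Icc _ _ (hd₁ i) (hd₂ i) ha hb hab⟩
  · exact add_nonneg (mul_nonneg ha hv₁) (mul_nonneg hb hv₂)
  · calc a * u₁.1 + b * u₂.1 ≤ a * M.vbar + b * M.vbar :=
          add_le_add (mul_le_mul_of_nonneg_left (hv₁'.trans (min_le_left _ _)) ha)
            (mul_le_mul_of_nonneg_left (hv₂'.trans (min_le_left _ _)) hb)
      _ = M.vbar := by rw [← add_mul, hab, one_mul]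
  · exact add_le_add (mul_le_mul_of_nonneg_left (hv₁'.trans (min_le_right _ _)) ha)
      (mul_le_mul_of_nonneg_left (hv₂'.trans (min_le_right _ _)) hb)

lemma totalLoad_combo (a b : ℝ) (u₁ u₂ : Decision K) :
    totalLoad (a • u₁ + b • u₂) = a * totalLoad u₁ + b * totalLoad u₂ := by
  simp only [totalLoad, Prod.fst_add, Prod.smul_fst, Prod.snd_add, Prod.smul_snd, Pi.add_apply,
    Pi.smul_apply, smul_eq_mul, Finset.sum_add_distrib, ← Finset.mul_sum]
  ring

/-- Concavity, Lipschitz continuity and slope at infinity of the expected value function. -/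
structure RegularValue (M : Prosumer K) (P : Measure Ω) (R : ℕ → Ω → ℝ) (t : ℕ) : Prop where
  concave : ConcaveOn ℝ (Ici 0) (M.expectedValue P R t)
  lipschitz : ∃ C, 0 ≤ C ∧ ∀ a, 0 ≤ a → ∀ b, 0 ≤ b →
    |M.expectedValue P R t a - M.expectedValue P R t b| ≤ C * |a - b|
  -- At most `(T - t) * vbar` can be charged from stage `t` on; any demand beyond that is left over
  -- and costs `γ` per unit.
  slope : ∀ a b, ((M.T : ℝ) - t) * M.vbar ≤ a → 0 ≤ a → a ≤ b →
    M.expectedValue P R t b ≤ M.expectedValue P R t a - M.γ * (b - a)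

lemma RegularValue.continuousOn (h : RegularValue M P R t) :
    ContinuousOn (M.expectedValue P R t) (Ici 0) := by
  obtain ⟨C, hC, hl⟩ := h.lipschitz
  have : LipschitzOnWith C.toNNReal (M.expectedValue P R t) (Ici 0) :=
    LipschitzOnWith.of_dist_le_mul fun x hx y hy => by
      simpa [Real.dist_eq, hC] using hl x hx y hy
  exact this.continuousOn

lemma continuousOn_bellmanObjective (hM : M.Regular) (ht : t < M.T)
    (hV : RegularValue M P R (t + 1)) (y r : ℝ) :
    ContinuousOn (M.bellmanObjective P R t y r) (M.feasible y) := by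
  unfold bellmanObjective stageReward
  refine ContinuousOn.add (ContinuousOn.sub (continuousOn_finsetSum _ fun i _ => ?_) ?_) ?_
  · exact (hM.contDiffOn t ht i).continuousOn.comp (by fun_prop) fun u hu => hu.2 i
  · refine Continuous.continuousOn (continuous_payment.comp ?_)
    unfold totalLoad
    fun_prop
  · exact hV.continuousOn.comp (by fun_prop)
      fun u hu => sub_nonneg.2 (hu.1.2.trans (min_le_right _ _))

lemma exists_isOptimalDecision (hM : M.Regular) (ht : t < M.T)
    (hV : RegularValue M P R (t + 1)) {y : ℝ} (hy : 0 ≤ y) (r : ℝ) :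
    ∃ u, M.IsOptimalDecision P R t y r u :=
  (isCompact_feasible M y).exists_isMaxOn (feasible_nonempty hM hy)
    (continuousOn_bellmanObjective hM ht hV y r)

lemma IsOptimalDecision.value_eq {y r : ℝ} {u : Decision K}
    (h : M.IsOptimalDecision P R t y r u) (ht : t < M.T) :
    M.value P R t y r = M.bellmanObjective P R t y r u := by
  rw [value_bellman M P R t ht]
  exact IsGreatest.csSup_eq ⟨mem_image_of_mem _ h.1, forall_mem_image.2 fun u' hu' => h.2 hu'⟩

lemma bellmanObjective_le_value (hM : M.Regular) (ht : t < M.T)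
    (hV : RegularValue M P R (t + 1)) {y r : ℝ} {u : Decision K} (hu : u ∈ M.feasible y) :
    M.bellmanObjective P R t y r u ≤ M.value P R t y r := by
  have hy : 0 ≤ y := hu.1.1.trans (hu.1.2.trans (min_le_right _ _))
  obtain ⟨u', hu'⟩ := exists_isOptimalDecision hM ht hV hy r
  rw [hu'.value_eq ht]
  exact hu'.2 hu

/-- Concavity is needed jointly in state and decision, so that it survives maximization over the
decision. -/
lemma bellmanObjective_concave (hM : M.Regular) (hA : M.PriceAssumption) (ht : t < M.T)
    (hV : RegularValue M P R (t + 1)) {y₁ y₂ r a b : ℝ} {u₁ u₂ : Decision K}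
    (h₁ : u₁ ∈ M.feasible y₁) (h₂ : u₂ ∈ M.feasible y₂) (ha : 0 ≤ a) (hb : 0 ≤ b)
    (hab : a + b = 1) :
    a * M.bellmanObjective P R t y₁ r u₁ + b * M.bellmanObjective P R t y₂ r u₂ ≤
      M.bellmanObjective P R t (a * y₁ + b * y₂) r (a • u₁ + b • u₂) := by
  have hU : a * ∑ i, M.U t i (u₁.2 i) + b * ∑ i, M.U t i (u₂.2 i) ≤
      ∑ i, M.U t i ((a • u₁ + b • u₂).2 i) := by
    rw [Finset.mul_sum, Finset.mul_sum, ← Finset.sum_add_distrib]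
    exact Finset.sum_le_sum fun i _ =>
      (hM.strictConcaveOn t ht i).concaveOn.2 (h₁.2 i) (h₂.2 i) ha hb hab
  have hP := (convexOn_payment (hA t ht).1).2 (mem_univ (totalLoad u₁ - r))
    (mem_univ (totalLoad u₂ - r)) ha hb hab
  have hW := hV.concave.2 (x := y₁ - u₁.1) (y := y₂ - u₂.1)
    (sub_nonneg.2 (h₁.1.2.trans (min_le_right _ _)))
    (sub_nonneg.2 (h₂.1.2.trans (min_le_right _ _))) ha hb hab
  simp only [smul_eq_mul] at hP hW
  have e₁ : totalLoad (a • u₁ + b • u₂) - r = a * (totalLoad u₁ - r) + b * (totalLoad u₂ - r) := by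
    rw [totalLoad_combo]
    linear_combination r * hab
  have e₂ : a * y₁ + b * y₂ - (a • u₁ + b • u₂).1 = a * (y₁ - u₁.1) + b * (y₂ - u₂.1) := by
    simp only [Prod.fst_add, Prod.smul_fst, smul_eq_mul]
    ring
  unfold bellmanObjective stageReward
  rw [e₁, e₂]
  linarith

/-! ### Regularity of the value function, by backward induction -/

lemma value_concave (hM : M.Regular) (hA : M.PriceAssumption) (ht : t < M.T)
    (hV : RegularValue M P R (t + 1)) (r : ℝ) :
    ConcaveOn ℝ (Ici 0) fun y => M.value P R t y r := by
  refine ⟨convex_Ici 0, fun y₁ hy₁ y₂ hy₂ a b ha hb hab => ?_⟩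
  obtain ⟨u₁, hu₁⟩ := exists_isOptimalDecision hM ht hV hy₁ r
  obtain ⟨u₂, hu₂⟩ := exists_isOptimalDecision hM ht hV hy₂ r
  simp only [smul_eq_mul]
  rw [hu₁.value_eq ht, hu₂.value_eq ht]
  exact (bellmanObjective_concave hM hA ht hV hu₁.1 hu₂.1 ha hb hab).trans
    (bellmanObjective_le_value hM ht hV (feasible_combo hu₁.1 hu₂.1 ha hb hab))

/-- An optimal decision for one state, with its charging cut to `min v y'`, is feasible for the
other. Net consumption and remaining demand then change by at most the distance of the states. -/
lemma value_lipschitz (hM : M.Regular) (hA : M.PriceAssumption) (ht : t < M.T)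
    (hV : RegularValue M P R (t + 1)) :
    ∃ C, 0 ≤ C ∧ ∀ y, 0 ≤ y → ∀ y', 0 ≤ y' → ∀ r r',
      |M.value P R t y r - M.value P R t y' r'| ≤ C * (|y - y'| + |r - r'|) := by
  obtain ⟨C, hC, hl⟩ := hV.lipschitz
  set c := |M.πp t| + |M.πm t|
  have hc : 0 ≤ c := by positivity
  have key : ∀ y, 0 ≤ y → ∀ y', 0 ≤ y' → ∀ r r',
      M.value P R t y r - M.value P R t y' r' ≤ (c + C) * (|y - y'| + |r - r'|) := by
    intro y hy y' hy' r r'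
    obtain ⟨⟨v, d⟩, hu⟩ := exists_isOptimalDecision hM ht hV hy r
    obtain ⟨⟨⟨hv0, hv⟩, hd⟩, -⟩ := id hu
    simp only [le_min_iff] at hv0 hv hd
    have hu' : ((min v y', d) : Decision K) ∈ M.feasible y' :=
      ⟨⟨le_min hv0 hy', le_min ((min_le_left _ _).trans hv.1) (min_le_right _ _)⟩, hd⟩
    have h := bellmanObjective_le_value (r := r') hM ht hV hu'
    rw [hu.value_eq ht]
    have hp := neg_le_of_abs_le (payment_lipschitz (hA t ht).1 (totalLoad ((v, d) : Decision K) - r)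
      (totalLoad ((min v y', d) : Decision K) - r'))
    have hw := le_of_abs_le (hl (y - v) (sub_nonneg.2 hv.2) (y' - min v y')
      (sub_nonneg.2 (min_le_right _ _)))
    have hyy := le_abs_self (y - y')
    have b₁ : |totalLoad ((v, d) : Decision K) - r - (totalLoad ((min v y', d) : Decision K) - r')|
        ≤ |y - y'| + |r - r'| := by
      have e : totalLoad ((v, d) : Decision K) - r - (totalLoad ((min v y', d) : Decision K) - r')
        = (v - min v y') - (r - r') := by
        simp only [totalLoad]
        ring
      rw [e]
      refine (abs_sub _ _).trans (add_le_add_left ?_ _)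
      rcases min_cases v y' with ⟨h1, h2⟩ | ⟨h1, h2⟩ <;> rw [h1]
      · simp
      · rw [abs_of_pos (by linarith)]
        linarith
    have b₂ : |y - v - (y' - min v y')| ≤ |y - y'| + |r - r'| := by
      have hr := abs_nonneg (r - r')
      rcases min_cases v y' with ⟨h1, h2⟩ | ⟨h1, h2⟩ <;> rw [h1]
      · rw [sub_sub_sub_cancel_right]
        linarith
      · rw [sub_self, sub_zero, abs_of_nonneg (by linarith)]
        linarith
    have m₁ := mul_le_mul_of_nonneg_left b₁ hc
    have m₂ := mul_le_mul_of_nonneg_left b₂ hC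
    unfold bellmanObjective stageReward at *
    simp only at h hp hw ⊢
    linarith
  refine ⟨c + C, by positivity, fun y hy y' hy' r r' => abs_sub_le_iff.2 ⟨key y hy y' hy' r r', ?_⟩⟩
  rw [abs_sub_comm y, abs_sub_comm r]
  exact key y' hy' y hy r' r

/-- Both demands are at least `vbar`, so an optimal decision at `b` is feasible at `a`, and both
remaining demands stay beyond the bound for stage `t + 1`. -/
lemma value_slope (hM : M.Regular) (ht : t < M.T) (hV : RegularValue M P R (t + 1))
    {a b : ℝ} (ha : ((M.T : ℝ) - t) * M.vbar ≤ a) (hab : a ≤ b) (r : ℝ) :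
    M.value P R t b r ≤ M.value P R t a r - M.γ * (b - a) := by
  have hT : (t : ℝ) + 1 ≤ M.T := by exact_mod_cast ht
  have hva : M.vbar ≤ a := by nlinarith [mul_nonneg (sub_nonneg.2 hT) hM.vbar_nonneg]
  have ha0 := hM.vbar_nonneg.trans hva
  obtain ⟨u, hu⟩ := exists_isOptimalDecision hM ht hV (ha0.trans hab) r
  have hv : u.1 ≤ M.vbar := hu.1.1.2.trans (min_le_left _ _)
  have hu' : u ∈ M.feasible a := ⟨⟨hu.1.1.1, le_min hv (hv.trans hva)⟩, hu.1.2⟩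
  have h := bellmanObjective_le_value (r := r) hM ht hV hu'
  have hs := hV.slope (a - u.1) (b - u.1) (by push_cast; nlinarith) (by linarith) (by linarith)
  rw [hu.value_eq ht]
  unfold bellmanObjective at *
  linarith

lemma expectedValue_terminal [IsProbabilityMeasure P] (y : ℝ) :
    M.expectedValue P R M.T y = -M.γ * y := by
  simp [expectedValue, value_terminal]

lemma integrable_value_of_regularValue [IsProbabilityMeasure P] (hM : M.Regular)
    (hA : M.PriceAssumption) (hRint : ∀ t, Integrable (R t) P)
    (ht : t < M.T) (hV : RegularValue M P R (t + 1)) {y : ℝ} (hy : 0 ≤ y) :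
    Integrable (fun ω => M.value P R t y (R t ω)) P := by
  obtain ⟨C, hC, hl⟩ := value_lipschitz hM hA ht hV
  have hlip : LipschitzWith C.toNNReal fun r => M.value P R t y r :=
    LipschitzWith.of_dist_le_mul fun r r' => by
      simpa [Real.dist_eq, hC] using hl y hy y hy r r'
  refine Integrable.mono' (((hRint t).norm.const_mul C).add (integrable_const |M.value P R t y 0|))
    (hlip.continuous.comp_aestronglyMeasurable (hRint t).aestronglyMeasurable) (.of_forall fun ω => ?_)
  have h1 := hl y hy y hy (R t ω) 0
  simp only [sub_self, abs_zero, zero_add, sub_zero] at h1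
  have h2 := abs_sub_abs_le_abs_sub (M.value P R t y (R t ω)) (M.value P R t y 0)
  simp only [Real.norm_eq_abs, Pi.add_apply]
  linarith

/-- The three properties hold for each `r` with constants independent of `r`, so averaging preserves
them. -/
lemma regularValue [IsProbabilityMeasure P] (hM : M.Regular) (hA : M.PriceAssumption)
    (hRint : ∀ t, Integrable (R t) P) (ht : t ≤ M.T) : RegularValue M P R t := by
  induction ht using Nat.decreasingInduction with
  | self =>
    refine ⟨⟨convex_Ici 0, fun x _ y _ a b _ _ _ => ?_⟩, ⟨|M.γ|, abs_nonneg _, fun a _ b _ => ?_⟩,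
      fun a b _ _ _ => ?_⟩ <;> simp only [expectedValue_terminal, smul_eq_mul]
    · linarith
    · rw [← mul_sub, abs_mul, abs_neg]
    · linarith
  | of_succ t ht ih =>
    have hint := fun {y} (hy : 0 ≤ y) =>
      integrable_value_of_regularValue (R := R) hM hA hRint ht ih hy
    refine ⟨⟨convex_Ici 0, fun x hx y hy a b ha hb hab => ?_⟩, ?_, fun a b ha ha0 hab => ?_⟩
    · simp only [smul_eq_mul, expectedValue]
      rw [← integral_const_mul, ← integral_const_mul,
        ← integral_add ((hint hx).const_mul _) ((hint hy).const_mul _)]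
      exact integral_mono (((hint hx).const_mul _).add ((hint hy).const_mul _))
        (hint (convex_Ici 0 hx hy ha hb hab))
        fun ω => (value_concave hM hA ht ih (R t ω)).2 hx hy ha hb hab
    · obtain ⟨C, hC, hl⟩ := value_lipschitz hM hA ht ih
      refine ⟨C, hC, fun a ha b hb => ?_⟩
      unfold expectedValue
      rw [← integral_sub (hint ha) (hint hb)]
      have hle : ∀ ω, ‖M.value P R t a (R t ω) - M.value P R t b (R t ω)‖ ≤ C * |a - b| :=
        fun ω => by simpa using hl a ha b hb (R t ω) (R t ω)
      simpa using norm_integral_le_of_norm_le_const (μ := P) (.of_forall hle)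
    · have h := integral_mono (hint (ha0.trans hab)) ((hint ha0).sub (integrable_const _))
        fun ω => value_slope hM ht ih ha hab (R t ω)
      simpa [expectedValue, integral_sub (hint ha0) (integrable_const _)] using h

lemma integrable_value [IsProbabilityMeasure P] (hM : M.Regular)
    (hA : M.PriceAssumption) (hRint : ∀ t, Integrable (R t) P)
    (ht : t ≤ M.T) {y : ℝ} (hy : 0 ≤ y) :
    Integrable (fun ω => M.value P R t y (R t ω)) P := by
  rcases ht.eq_or_lt with rfl | ht
  · simp only [value_terminal, integrable_const]
  · exact integrable_value_of_regularValue hM hA hRint ht (regularValue hM hA hRint ht) hy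

end Prosumer

namespace Prosumer

variable {K : ℕ} {M : Prosumer K} {t : ℕ}
  {Ω : Type*} [MeasurableSpace Ω] {P : Measure Ω} {R : ℕ → Ω → ℝ}

/-! ### Subdifferential and charging thresholds -/

/-- Add the two supporting inequalities. With the sign `-ν`, thresholds increase with the price. -/
lemma subdiff_monotone {θ₁ θ₂ ν₁ ν₂ : ℝ} (hθ₁ : 0 ≤ θ₁) (hθ₂ : 0 ≤ θ₂)
    (h₁ : -ν₁ ∈ M.subdiff P R t θ₁) (h₂ : -ν₂ ∈ M.subdiff P R t θ₂) :
    0 ≤ (θ₂ - θ₁) * (ν₂ - ν₁) := by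
  have a := h₁ θ₂ hθ₂
  have b := h₂ θ₁ hθ₁
  linarith

lemma le_of_subdiff {θ₁ θ₂ ν₁ ν₂ : ℝ} (hθ₁ : 0 ≤ θ₁) (hθ₂ : 0 ≤ θ₂)
    (h₁ : -ν₁ ∈ M.subdiff P R t θ₁) (h₂ : -ν₂ ∈ M.subdiff P R t θ₂) (h : ν₁ < ν₂) :
    θ₁ ≤ θ₂ :=
  sub_nonneg.1 (nonneg_of_mul_nonneg_left (subdiff_monotone hθ₁ hθ₂ h₁ h₂) (sub_pos.2 h))

lemma IsThresholds.le {τ δ : ℕ → ℝ} (h : M.IsThresholds P R τ δ) (hA : M.PriceAssumption)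
    (ht : t < M.T) : δ t ≤ τ t := by
  obtain ⟨hτ, hδ, hp, hm, he⟩ := h t ht
  rcases (hA t ht).1.eq_or_lt with e | e
  · exact he e
  · exact le_of_subdiff hδ hτ hm hp e

/-- For a price not exceeding the penalty there is a charging threshold that never exceeds what
can still be charged later. -/
lemma exists_threshold (hM : M.Regular) (ht : t ≤ M.T) (hV : RegularValue M P R t) {p : ℝ}
    (hp : p ≤ M.γ) :
    ∃ θ ∈ Icc 0 (((M.T : ℝ) - t) * M.vbar), -p ∈ M.subdiff P R t θ := by
  set N := ((M.T : ℝ) - t) * M.vbar with hN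
  have hN0 : 0 ≤ N := mul_nonneg (sub_nonneg.2 (by exact_mod_cast ht)) hM.vbar_nonneg
  have hcont : ContinuousOn (fun y => M.expectedValue P R t y + p * y) (Icc 0 N) :=
    (hV.continuousOn.mono fun y hy => hy.1).add (by fun_prop)
  -- A global maximizer of `V̄ + p y` has supergradient `-p`. Beyond `N` this function does not
  -- increase, because `p ≤ γ`, so the maximum over `[0, N]` is global.
  obtain ⟨θ, hθ, hmax⟩ := isCompact_Icc.exists_isMaxOn (nonempty_Icc.2 hN0) hcont
  refine ⟨θ, hθ, fun y hy => ?_⟩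
  rcases le_total y N with hyN | hyN
  · have := hmax (show y ∈ Icc 0 N from ⟨hy, hyN⟩)
    simp only [mem_ofPred_eq] at this
    linarith
  · have h₁ := hmax (show N ∈ Icc 0 N from ⟨hN0, le_rfl⟩)
    have h₂ := hV.slope N y hN.ge hN0 hyN
    simp only [mem_ofPred_eq] at h₁
    nlinarith [mul_nonneg (sub_nonneg.2 hp) (sub_nonneg.2 hyN)]

lemma exists_isThresholds (hM : M.Regular) (hA : M.PriceAssumption)
    (hV : ∀ t ≤ M.T, RegularValue M P R t) :
    ∃ τ δ : ℕ → ℝ, M.IsThresholds P R τ δ ∧ ∀ t < M.T, δ t ≤ τ t ∧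
      τ t ∈ Icc 0 (((M.T : ℝ) - t - 1) * M.vbar) ∧
      δ t ∈ Icc 0 (((M.T : ℝ) - t - 1) * M.vbar) := by
  -- A single function of the price yields both thresholds, so they coincide when the prices do.
  have key : ∀ t, ∃ f : ℝ → ℝ, t < M.T → ∀ p ≤ M.γ,
      f p ∈ Icc 0 (((M.T : ℝ) - t - 1) * M.vbar) ∧ -p ∈ M.subdiff P R (t + 1) (f p) := by
    intro t
    by_cases ht : t < M.T
    · have h : ∀ p, ∃ θ, p ≤ M.γ → θ ∈ Icc 0 (((M.T : ℝ) - t - 1) * M.vbar) ∧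
          -p ∈ M.subdiff P R (t + 1) θ := by
        intro p
        by_cases hp : p ≤ M.γ
        · obtain ⟨θ, h₁, h₂⟩ := exists_threshold hM ht (hV (t + 1) ht) hp
          push_cast at h₁
          rw [← sub_sub] at h₁
          exact ⟨θ, fun _ => ⟨h₁, h₂⟩⟩
        · exact ⟨0, fun h => absurd h hp⟩
      choose f hf using h
      exact ⟨f, fun _ p hp => hf p hp⟩
    · exact ⟨0, fun h => absurd h ht⟩
  choose f hf using key
  have hth : M.IsThresholds P R (fun t => f t (M.πp t)) (fun t => f t (M.πm t)) := by
    intro t ht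
    have h₁ := hf t ht _ (hA t ht).2
    have h₂ := hf t ht _ ((hA t ht).1.trans (hA t ht).2)
    exact ⟨h₁.1.1, h₂.1.1, h₁.2, h₂.2, fun e => by simp only [e, le_refl]⟩
  exact ⟨_, _, hth, fun t ht => ⟨hth.le hA ht, (hf t ht _ (hA t ht).2).1,
    (hf t ht _ ((hA t ht).1.trans (hA t ht).2)).1⟩⟩

lemma chargeTo_antitone (M : Prosumer K) (y : ℝ) : Antitone fun θ => M.chargeTo θ y :=
  fun _ _ h => min_le_min le_rfl (max_le_max (by linarith) le_rfl)

lemma chargeTo_mem (hM : M.Regular) {θ y : ℝ} (hθ : 0 ≤ θ) (hy : 0 ≤ y) :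
    M.chargeTo θ y ∈ Icc 0 (min M.vbar y) :=
  ⟨le_min hM.vbar_nonneg (le_max_right _ _),
    min_le_min le_rfl (max_le (by linarith) hy)⟩

lemma rule_mem_feasible (hM : M.Regular) (ht : t < M.T) {θ y : ℝ} (hθ : 0 ≤ θ) (hy : 0 ≤ y)
    (ν : ℝ) : (M.chargeTo θ y, M.invMarginal t ν) ∈ M.feasible y :=
  ⟨chargeTo_mem hM hθ hy, invMarginal_mem hM ht ν⟩

/-- Charging down to the threshold `θ` is optimal for the marginal price `ν`. -/
lemma charging_le_chargeTo (hV : RegularValue M P R t) {θ ν y v : ℝ}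
    (hθ : 0 ≤ θ) (hν : -ν ∈ M.subdiff P R t θ) (hv : v ∈ Icc 0 (min M.vbar y)) :
    M.expectedValue P R t (y - v) - ν * v ≤
      M.expectedValue P R t (y - M.chargeTo θ y) - ν * M.chargeTo θ y := by
  set c := M.chargeTo θ y with hc
  obtain ⟨hv0, hv1⟩ := hv
  obtain ⟨hvb, hvy⟩ := le_min_iff.1 hv1
  have h0 := hν (y - v) (by linarith)
  -- the state `y - c` lies between `θ` and `y - v`
  have hcases : y - c = θ ∨ (θ < y - c ∧ y - c ≤ y - v) ∨ (y - c < θ ∧ y - v ≤ y - c) := by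
    rw [hc, chargeTo]
    rcases le_total y θ with h | h
    · rw [max_eq_right (by linarith), min_eq_right (hv0.trans hvb)]
      rcases h.eq_or_lt with h | h
      · left; linarith
      · right; right; constructor <;> linarith
    · rw [max_eq_left (by linarith)]
      rcases le_or_gt (y - θ) M.vbar with h' | h'
      · rw [min_eq_right h']; left; ring
      · rw [min_eq_left h'.le]; right; left; constructor <;> linarith
  -- by concavity the objective at `y - c` is at least the one at `y - v`
  have key : ∀ x z, 0 ≤ z → (∃ s ∈ Icc (0 : ℝ) 1, x = θ + s * (z - θ)) →
      M.expectedValue P R t z + ν * z ≤ M.expectedValue P R t x + ν * x := by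
    rintro x z hz ⟨s, hs, rfl⟩
    have hcv := hV.concave.2 (x := θ) (y := z) hθ hz (sub_nonneg.2 hs.2) hs.1 (by ring)
    simp only [smul_eq_mul] at hcv
    rw [show (1 - s) * θ + s * z = θ + s * (z - θ) by ring] at hcv
    nlinarith [mul_nonneg (sub_nonneg.2 hs.2) (sub_nonneg.2 (hν z hz))]
  rcases hcases with h | ⟨h₁, h₂⟩ | ⟨h₁, h₂⟩
  · rw [h]
    linear_combination h0 - ν * h
  · have hd : 0 < y - v - θ := by linarith
    have := key (y - c) (y - v) (by linarith)
      ⟨(y - c - θ) / (y - v - θ), ⟨by apply div_nonneg <;> linarith, by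
        rw [div_le_one hd]; linarith⟩, by field_simp; ring⟩
    linarith
  · have hd : 0 < θ - (y - v) := by linarith
    have := key (y - c) (y - v) (by linarith)
      ⟨(θ - (y - c)) / (θ - (y - v)), ⟨by apply div_nonneg <;> linarith, by
        rw [div_le_one hd]; linarith⟩, by field_simp; ring⟩
    linarith

/-! ### Optimality of the threshold rules -/

/-- A threshold rule for the marginal price `ν` is optimal if `ν` supports the payment at its net
consumption, and any other optimal decision has the same consumption. -/
lemma rule_isOptimal (hM : M.Regular) (ht : t < M.T) (hV : RegularValue M P R (t + 1))
    {θ ν y r : ℝ} (hθ : 0 ≤ θ) (hy : 0 ≤ y) (hsub : -ν ∈ M.subdiff P R (t + 1) θ)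
    (hν : ν ∈ Icc (M.πm t) (M.πp t))
    (hpay : M.payment t (totalLoad (M.chargeTo θ y, M.invMarginal t ν) - r) =
      ν * (totalLoad (M.chargeTo θ y, M.invMarginal t ν) - r)) :
    M.IsOptimalDecision P R t y r (M.chargeTo θ y, M.invMarginal t ν) ∧
      ∀ u, M.IsOptimalDecision P R t y r u → u.2 = M.invMarginal t ν := by
  have hfeas := rule_mem_feasible hM ht hθ hy ν
  -- The separated upper bound; by `hpay` it is attained at the rule.
  have hrel : ∀ u, M.bellmanObjective P R t y r u ≤ (∑ i, (M.U t i (u.2 i) - ν * u.2 i)) +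
      (M.expectedValue P R (t + 1) (y - u.1) - ν * u.1) + ν * r := by
    intro u
    have := mul_le_payment hν (totalLoad u - r)
    rw [totalLoad] at this
    rw [bellmanObjective, stageReward, totalLoad, Finset.sum_sub_distrib, ← Finset.mul_sum]
    linarith
  have heq : M.bellmanObjective P R t y r (M.chargeTo θ y, M.invMarginal t ν) =
      (∑ i, (M.U t i (M.invMarginal t ν i) - ν * M.invMarginal t ν i)) +
      (M.expectedValue P R (t + 1) (y - M.chargeTo θ y) - ν * M.chargeTo θ y) + ν * r := by
    rw [bellmanObjective, stageReward, hpay, totalLoad, Finset.sum_sub_distrib, ← Finset.mul_sum]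
    ring
  have hopt : M.IsOptimalDecision P R t y r (M.chargeTo θ y, M.invMarginal t ν) := by
    refine ⟨hfeas, fun u hu => ?_⟩
    have hs := Finset.sum_le_sum fun i (_ : i ∈ Finset.univ) =>
      surplus_le_invMarginal hM ht ν i (hu.2 i)
    have hc := charging_le_chargeTo hV hθ hsub hu.1
    have h := hrel u
    simp only [mem_ofPred_eq]
    linarith
  refine ⟨hopt, fun u hu => funext fun i => eq_invMarginal hM ht ν i (hu.1.2 i) ?_⟩
  -- One load with less than maximal surplus puts the upper bound for `u` strictly below the
  -- optimum.
  by_contra! hlt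
  have hs := Finset.sum_lt_sum
    (fun i _ => surplus_le_invMarginal hM ht ν i (hu.1.2 i)) ⟨i, Finset.mem_univ i, hlt⟩
  have hc := charging_le_chargeTo hV hθ hsub hu.1.1
  have h := hrel u
  have hge := hu.2 hfeas
  simp only [mem_ofPred_eq] at hge
  linarith

/-- Each renewable threshold is the total load under its rule, so comparing it with `r` gives the
sign of the net consumption and thus a supporting price. -/
lemma HasThresholdStructure.isOptimal (hM : M.Regular) (hA : M.PriceAssumption)
    (hV : ∀ t ≤ M.T, RegularValue M P R t) {τ δ : ℕ → ℝ} (hth : M.IsThresholds P R τ δ)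
    {μ : Policy K} (hμ : M.HasThresholdStructure P R τ δ μ) (ht : t < M.T) {y : ℝ} (hy : 0 ≤ y)
    (r : ℝ) :
    M.IsOptimalDecision P R t y r (μ t y r) ∧
      ∀ u, M.IsOptimalDecision P R t y r u → u.2 = (μ t y r).2 := by
  obtain ⟨hτ, hδ, hp, hm, -⟩ := hth t ht
  obtain ⟨h₁, h₂, h₃⟩ := hμ t ht y hy r
  have hpm := (hA t ht).1
  have hW := hV (t + 1) ht
  rcases lt_or_ge r (M.renewableThreshold t (M.πp t) (τ t) y) with hr | hr
  · rw [h₁ hr]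
    exact rule_isOptimal hM ht hW hτ hy hp ⟨hpm, le_rfl⟩
      (payment_of_nonneg (sub_nonneg.2 hr.le))
  rcases lt_or_ge (M.renewableThreshold t (M.πm t) (δ t) y) r with hr' | hr'
  · rw [h₂ hr']
    exact rule_isOptimal hM ht hW hδ hy hm ⟨le_rfl, hpm⟩
      (payment_of_nonpos (sub_nonpos.2 hr'.le))
  obtain ⟨ν, hν, θ, hθ, hs, hu, htot⟩ := h₃ ⟨hr, hr'⟩
  rw [hu] at htot ⊢
  exact rule_isOptimal hM ht hW hθ hy hs hν (by rw [htot]; simp [payment])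

lemma renewableThreshold_le (hM : M.Regular) (ht : t < M.T) {p q θ₁ θ₂ : ℝ} (hpq : q ≤ p)
    (hθ : θ₂ ≤ θ₁) (y : ℝ) :
    M.renewableThreshold t p θ₁ y ≤ M.renewableThreshold t q θ₂ y :=
  add_le_add (chargeTo_antitone M y hθ)
    (Finset.sum_le_sum fun i _ => invMarginal_antitone hM ht i hpq)

/-! ### Monotonicity in the net-zero zone -/

/-- A lower price raises every component. If `ν₁ < ν₂`, then `u₁` dominates `u₂` while its total is
no larger, so they agree; at equal prices the consumptions agree and charging absorbs the change in
`r`. -/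
lemma NetZeroRule.mono (hM : M.Regular) (ht : t < M.T) {y r₁ r₂ : ℝ} {u₁ u₂ : Decision K}
    (h₁ : M.NetZeroRule P R t y r₁ u₁) (h₂ : M.NetZeroRule P R t y r₂ u₂) (hr : r₁ ≤ r₂) :
    u₁ ≤ u₂ := by
  obtain ⟨ν₁, -, θ₁, hθ₁, hs₁, rfl, e₁⟩ := h₁
  obtain ⟨ν₂, -, θ₂, hθ₂, hs₂, rfl, e₂⟩ := h₂
  simp only [totalLoad] at e₁ e₂
  rcases lt_trichotomy ν₁ ν₂ with h | rfl | h
  · have hc := chargeTo_antitone M y (le_of_subdiff hθ₁ hθ₂ hs₁ hs₂ h)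
    have hd := fun i => invMarginal_antitone hM ht i h.le
    have hsum := Finset.sum_le_sum fun i (_ : i ∈ Finset.univ) => hd i
    simp only at hc hsum
    have hv : M.chargeTo θ₁ y = M.chargeTo θ₂ y := by linarith
    have he := (Finset.sum_eq_sum_iff_of_le fun i _ => hd i).1
      (show ∑ i, M.invMarginal t ν₂ i = ∑ i, M.invMarginal t ν₁ i by linarith)
    exact ⟨hv.le, fun i => (he i (Finset.mem_univ i)).ge⟩
  · exact ⟨by linarith, le_rfl⟩
  · exact ⟨chargeTo_antitone M y (le_of_subdiff hθ₂ hθ₁ hs₂ hs₁ h),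
      fun i => invMarginal_antitone hM ht i h.le⟩

end Prosumer

/-- Measurable selection of the level at which a continuous antitone function crosses a value. -/
lemma exists_measurable_crossing {F : ℝ → ℝ → ℝ} (hF : Continuous fun p : ℝ × ℝ => F p.1 p.2)
    (hanti : ∀ y, Antitone (F y)) {a b : ℝ} (hab : a ≤ b) :
    ∃ S : ℝ → ℝ → ℝ, (Measurable fun p : ℝ × ℝ => S p.1 p.2) ∧ ∀ y r,
      (r < F y b → S y r = b) ∧ (F y a < r → S y r = a) ∧
      (r ∈ Icc (F y b) (F y a) → F y (S y r) = r) := by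
  -- The selection is the least level with `F y s ≤ r`; adjoining `b` keeps the set nonempty and
  -- supplies the value when `r < F y b`.
  set A : ℝ → ℝ → Set ℝ := fun y r => Icc a b ∩ ({s | F y s ≤ r} ∪ {b}) with hA
  have hFy : ∀ y, Continuous (F y) := fun y => hF.comp (Continuous.prodMk_right y)
  have hbA : ∀ y r, b ∈ A y r := fun y r => ⟨⟨hab, le_rfl⟩, Or.inr rfl⟩
  have hbdd : ∀ y r, BddBelow (A y r) := fun y r => ⟨a, fun s hs => hs.1.1⟩
  have hmem : ∀ y r, sInf (A y r) ∈ A y r := fun y r =>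
    (isClosed_Icc.inter ((isClosed_le (hFy y) continuous_const).union
      isClosed_singleton)).csInf_mem ⟨b, hbA y r⟩ (hbdd y r)
  refine ⟨fun y r => sInf (A y r), measurable_of_Iic fun c => ?_, fun y r => ⟨fun h => ?_,
    fun h => ?_, fun h => ?_⟩⟩
  · rcases lt_or_ge c a with hca | hac
    · convert MeasurableSet.empty
      exact eq_empty_of_forall_notMem fun p hp =>
        absurd ((hmem p.1 p.2).1.1.trans hp) (not_le.2 hca)
    rcases le_or_gt b c with hbc | hcb
    · convert MeasurableSet.univ
      exact eq_univ_of_forall fun p => (hmem p.1 p.2).1.2.trans hbc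
    -- By antitonicity, whether the infimum is at most `c` is decided by the value of `F` at `c`
    -- alone.
    · have : (fun p : ℝ × ℝ => sInf (A p.1 p.2)) ⁻¹' Iic c = {p | F p.1 c ≤ p.2} := by
        ext p
        simp only [mem_preimage, mem_Iic, mem_ofPred_eq]
        constructor
        · intro h
          rcases (hmem p.1 p.2).2 with h' | h'
          · exact (hanti p.1 h).trans h'
          · exact absurd (h'.symm.le.trans h) (not_le.2 hcb)
        · exact fun h => csInf_le (hbdd _ _) ⟨⟨hac, hcb.le⟩, Or.inl h⟩
      rw [this]
      exact measurableSet_le (hF.measurable.comp (measurable_fst.prodMk measurable_const))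
        measurable_snd
  · rcases (hmem y r).2 with h' | h'
    · exact absurd ((hanti y (hmem y r).1.2).trans h') (not_le.2 h)
    · exact h'
  · exact le_antisymm (csInf_le (hbdd _ _) ⟨⟨le_rfl, hab⟩, Or.inl h.le⟩) (hmem y r).1.1
  · have hle : F y (sInf (A y r)) ≤ r := by
      rcases (hmem y r).2 with h' | h'
      · exact h'
      · rw [mem_singleton_iff.1 h']
        exact h.1
    -- A level with value exactly `r` exists at or before the infimum; minimality makes it the
    -- infimum.
    obtain ⟨s, hs, hsr⟩ := intermediate_value_Icc' (hmem y r).1.1 (hFy y).continuousOn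
      (show r ∈ Icc (F y (sInf (A y r))) (F y a) from ⟨hle, h.2⟩)
    have := csInf_le (hbdd y r) ⟨⟨hs.1, hs.2.trans (hmem y r).1.2⟩, Or.inl hsr.le⟩
    exact (congrArg (F y) (le_antisymm this hs.2)).trans hsr

namespace Prosumer

variable {K : ℕ} {M : Prosumer K} {t : ℕ}
  {Ω : Type*} [MeasurableSpace Ω] {P : Measure Ω} {R : ℕ → Ω → ℝ}

/-! ### A measurable policy with the threshold structure -/

/-- Resolvent of the subdifferential between two thresholds. -/
lemma exists_resolvent (hV : RegularValue M P R t) {δ τ q p : ℝ} (hδ : 0 ≤ δ) (hδτ : δ ≤ τ)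
    (hq : -q ∈ M.subdiff P R t δ) (hp : -p ∈ M.subdiff P R t τ) {s : ℝ}
    (hs : s ∈ Icc (δ + q) (τ + p)) :
    ∃ θ ∈ Icc δ τ, -(s - θ) ∈ M.subdiff P R t θ := by
  -- Stationarity of this function at `θ` is the desired inclusion.
  have hcont : ContinuousOn (fun θ => M.expectedValue P R t θ + s * θ - θ ^ 2 / 2) (Icc δ τ) :=
    ((hV.continuousOn.mono fun y hy => hδ.trans hy.1).add (by fun_prop)).sub (by fun_prop)
  obtain ⟨θ, hθ, hmax⟩ := isCompact_Icc.exists_isMaxOn (nonempty_Icc.2 hδτ) hcont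
  have hθ0 : 0 ≤ θ := hδ.trans hθ.1
  -- Outside `[δ, τ]` the supergradients at the end points and the range of `s` show that the end
  -- points do at least as well.
  have hglob : ∀ x, 0 ≤ x → M.expectedValue P R t x + s * x - x ^ 2 / 2 ≤
      M.expectedValue P R t θ + s * θ - θ ^ 2 / 2 := by
    intro x hx
    rcases le_total x δ with hxδ | hxδ
    · have h₁ := hmax (show δ ∈ Icc δ τ from ⟨le_rfl, hδτ⟩)
      have h₂ := hq x hx
      simp only [mem_ofPred_eq] at h₁
      nlinarith [mul_nonneg (sub_nonneg.2 hxδ) (sub_nonneg.2 hs.1), sq_nonneg (δ - x)]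
    rcases le_total τ x with hτx | hτx
    · have h₁ := hmax (show τ ∈ Icc δ τ from ⟨hδτ, le_rfl⟩)
      have h₂ := hp x hx
      simp only [mem_ofPred_eq] at h₁
      nlinarith [mul_nonneg (sub_nonneg.2 hτx) (sub_nonneg.2 hs.2), sq_nonneg (τ - x)]
    · exact hmax (show x ∈ Icc δ τ from ⟨hxδ, hτx⟩)
  refine ⟨θ, hθ, fun x hx => ?_⟩
  -- Compare `θ` with the point at fraction `l` towards `x`: the quadratic error is of order `l ^ 2`
  -- and vanishes after division by `l` as `l → 0`.
  have hlim : ∀ l ∈ Ioc (0 : ℝ) 1, M.expectedValue P R t x ≤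
      M.expectedValue P R t θ + -(s - θ) * (x - θ) + l * ((x - θ) ^ 2 / 2) := by
    intro l hl
    have hcv := hV.concave.2 (x := θ) (y := x) hθ0 hx (sub_nonneg.2 hl.2) hl.1.le (by ring)
    have hg := hglob ((1 - l) * θ + l * x)
      (add_nonneg (mul_nonneg (sub_nonneg.2 hl.2) hθ0) (mul_nonneg hl.1.le hx))
    simp only [smul_eq_mul] at hcv
    refine le_of_mul_le_mul_left ?_ hl.1
    linarith
  refine le_of_forall_pos_le_add fun ε hε => ?_
  set D := (x - θ) ^ 2 / 2 with hD
  have hD0 : 0 ≤ D := by positivity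
  have hl : min 1 (ε / (D + 1)) ∈ Ioc (0 : ℝ) 1 :=
    ⟨lt_min one_pos (by positivity), min_le_left _ _⟩
  have h₁ : min 1 (ε / (D + 1)) * D ≤ ε := by
    calc min 1 (ε / (D + 1)) * D ≤ ε / (D + 1) * (D + 1) := by
          gcongr
          · exact min_le_right _ _
          · linarith
      _ = ε := by field_simp
  linarith [hlim _ hl]

/-- The graph of the subdifferential between two thresholds is a continuous monotone curve. -/
lemma exists_price_curve (hV : RegularValue M P R t) {δ τ q p : ℝ} (hδ : 0 ≤ δ) (hδτ : δ ≤ τ)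
    (hqp : q ≤ p) (hq : -q ∈ M.subdiff P R t δ) (hp : -p ∈ M.subdiff P R t τ) :
    ∃ (a b : ℝ) (Θ N : ℝ → ℝ), a ≤ b ∧ Continuous Θ ∧ Continuous N ∧ Monotone Θ ∧ Monotone N ∧
      (∀ s, 0 ≤ Θ s ∧ N s ∈ Icc q p ∧ -N s ∈ M.subdiff P R t (Θ s)) ∧
      Θ a = δ ∧ N a = q ∧ Θ b = τ ∧ N b = p := by
  have hab : δ + q ≤ τ + p := add_le_add hδτ hqp
  have hτ : 0 ≤ τ := hδ.trans hδτ
  choose θ hθ hsub using fun s : Icc (δ + q) (τ + p) => exists_resolvent hV hδ hδτ hq hp s.2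
  -- Minty's parametrization by `s = θ + ν`: both coordinates are nondecreasing with sum `s`, hence
  -- 1-Lipschitz, across kinks and linear pieces of `V̄` alike. Applied with `s₁ = s₂` in both
  -- directions, it gives uniqueness of `θ` and so the end points.
  have hmono : ∀ {θ₁ θ₂ s₁ s₂ : ℝ}, 0 ≤ θ₁ → 0 ≤ θ₂ → s₁ ≤ s₂ →
      -(s₁ - θ₁) ∈ M.subdiff P R t θ₁ → -(s₂ - θ₂) ∈ M.subdiff P R t θ₂ →
      θ₁ ≤ θ₂ ∧ s₁ - θ₁ ≤ s₂ - θ₂ := by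
    intro θ₁ θ₂ s₁ s₂ h₁ h₂ hs hs₁ hs₂
    have := subdiff_monotone h₁ h₂ hs₁ hs₂
    constructor <;> by_contra! hc <;> nlinarith
  have hm : ∀ s₁ s₂ : Icc (δ + q) (τ + p), s₁ ≤ s₂ →
      θ s₁ ≤ θ s₂ ∧ (s₁ : ℝ) - θ s₁ ≤ s₂ - θ s₂ := fun s₁ s₂ h =>
    hmono (hδ.trans (hθ s₁).1) (hδ.trans (hθ s₂).1) h (hsub s₁) (hsub s₂)
  have hcont : Continuous θ := by
    refine LipschitzWith.continuous (K := 1) (LipschitzWith.of_dist_le_mul fun s₁ s₂ => ?_)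
    rw [NNReal.coe_one, one_mul, Subtype.dist_eq, Real.dist_eq, Real.dist_eq]
    rcases le_total s₁ s₂ with h | h
    · obtain ⟨h₁, h₂⟩ := hm _ _ h
      rw [abs_sub_comm, abs_of_nonneg (by linarith), abs_sub_comm, abs_of_nonneg (by linarith)]
      linarith
    · obtain ⟨h₁, h₂⟩ := hm _ _ h
      rw [abs_of_nonneg (by linarith), abs_of_nonneg (by linarith)]
      linarith
  have hleft : θ ⟨δ + q, left_mem_Icc.2 hab⟩ = δ := by
    have h := hsub ⟨δ + q, left_mem_Icc.2 hab⟩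
    have h' : -(δ + q - δ) ∈ M.subdiff P R t δ := by simpa using hq
    have h0 := hδ.trans (hθ ⟨δ + q, left_mem_Icc.2 hab⟩).1
    exact le_antisymm (hmono h0 hδ le_rfl h h').1 (hmono hδ h0 le_rfl h' h).1
  have hright : θ ⟨τ + p, right_mem_Icc.2 hab⟩ = τ := by
    have h := hsub ⟨τ + p, right_mem_Icc.2 hab⟩
    have h' : -(τ + p - τ) ∈ M.subdiff P R t τ := by simpa using hp
    have h0 := hδ.trans (hθ ⟨τ + p, right_mem_Icc.2 hab⟩).1
    exact le_antisymm (hmono h0 hτ le_rfl h h').1 (hmono hτ h0 le_rfl h' h).1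
  -- The projection extends the curve by constants to the whole line.
  refine ⟨δ + q, τ + p, fun s => θ (projIcc _ _ hab s),
    fun s => (projIcc _ _ hab s : ℝ) - θ (projIcc _ _ hab s), hab, by fun_prop, by fun_prop,
    fun s₁ s₂ h => (hm _ _ (monotone_projIcc hab h)).1,
    fun s₁ s₂ h => (hm _ _ (monotone_projIcc hab h)).2,
    fun s => ⟨hδ.trans (hθ _).1, ⟨?_, ?_⟩, hsub _⟩, ?_, ?_, ?_, ?_⟩
  · have := (hm ⟨δ + q, left_mem_Icc.2 hab⟩ (projIcc _ _ hab s) (projIcc _ _ hab s).2.1).2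
    rw [hleft] at this
    simpa using this
  · have := (hm (projIcc _ _ hab s) ⟨τ + p, right_mem_Icc.2 hab⟩ (projIcc _ _ hab s).2.2).2
    rw [hright] at this
    simpa using this
  · simp only [projIcc_left, hleft]
  · simp only [projIcc_left, hleft, add_sub_cancel_left]
  · simp only [projIcc_right, hright]
  · simp only [projIcc_right, hright, add_sub_cancel_left]

lemma continuous_chargeTo (M : Prosumer K) : Continuous fun p : ℝ × ℝ => M.chargeTo p.1 p.2 := by
  unfold chargeTo
  fun_prop

/-- The policy follows the price curve to the level at which the total load crosses `r`, stopping at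
the end `b` (buying price) under net consumption and at `a` (selling price) under net production. -/
lemma exists_threshold_policy (hM : M.Regular) (hA : M.PriceAssumption)
    (hV : ∀ t ≤ M.T, RegularValue M P R t) {τ δ : ℕ → ℝ} (hth : M.IsThresholds P R τ δ) :
    ∃ μ, M.Admissible μ ∧ M.HasThresholdStructure P R τ δ μ := by
  have stage : ∀ t, ∃ g : ℝ → ℝ → Decision K, t < M.T →
      (Measurable fun s : ℝ × ℝ => g s.1 s.2) ∧ ∀ y, 0 ≤ y → ∀ r, g y r ∈ M.feasible y ∧
      (r < M.renewableThreshold t (M.πp t) (τ t) y →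
        g y r = (M.chargeTo (τ t) y, M.invMarginal t (M.πp t))) ∧
      (M.renewableThreshold t (M.πm t) (δ t) y < r →
        g y r = (M.chargeTo (δ t) y, M.invMarginal t (M.πm t))) ∧
      (r ∈ Icc (M.renewableThreshold t (M.πp t) (τ t) y)
          (M.renewableThreshold t (M.πm t) (δ t) y) → M.NetZeroRule P R t y r (g y r)) := by
    intro t
    by_cases ht : t < M.T
    swap
    · exact ⟨fun _ _ => 0, fun h => absurd h ht⟩
    obtain ⟨-, hδ, hp, hm, -⟩ := hth t ht
    obtain ⟨a, b, Θ, N, hab, hΘc, hNc, hΘm, hNm, hcurve, hΘa, hNa, hΘb, hNb⟩ :=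
      exists_price_curve (hV (t + 1) ht) hδ (hth.le hA ht) (hA t ht).1 hm hp
    have hl := fun i => continuous_invMarginal hM ht i
    have hc := continuous_chargeTo M
    obtain ⟨S, hS, hSspec⟩ := exists_measurable_crossing
      (F := fun y s => M.renewableThreshold t (N s) (Θ s) y)
      ((hc.comp (by fun_prop : Continuous fun p : ℝ × ℝ => (Θ p.2, p.1))).add
        (continuous_finsetSum _ fun i _ => (hl i).comp (hNc.comp continuous_snd)))
      (fun y s₁ s₂ h => renewableThreshold_le hM ht (hNm h) (hΘm h) y) hab
    refine ⟨fun y r => (M.chargeTo (Θ (S y r)) y, M.invMarginal t (N (S y r))), fun _ => ⟨?_, ?_⟩⟩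
    · refine Measurable.prodMk ?_ (measurable_pi_iff.2 fun i => ?_)
      · exact hc.measurable.comp ((hΘc.measurable.comp hS).prodMk measurable_fst)
      · exact (hl i).measurable.comp (hNc.measurable.comp hS)
    · intro y hy r
      obtain ⟨h₁, h₂, h₃⟩ := hSspec y r
      simp only [hΘa, hΘb, hNa, hNb] at h₁ h₂ h₃
      obtain ⟨hΘ0, hN, hsub⟩ := hcurve (S y r)
      refine ⟨rule_mem_feasible hM ht hΘ0 hy _, fun h => ?_, fun h => ?_, fun h => ?_⟩
      · simp only [h₁ h, hΘb, hNb]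
      · simp only [h₂ h, hΘa, hNa]
      · exact ⟨_, hN, _, hΘ0, hsub, rfl, h₃ h⟩
  choose μ hμ using stage
  exact ⟨μ, ⟨fun t ht => (hμ t ht).1, fun t ht y hy r => ((hμ t ht).2 y hy r).1⟩,
    fun t ht y hy r => ((hμ t ht).2 y hy r).2⟩

end Prosumer

namespace Prosumer

variable {K : ℕ} {M : Prosumer K} {t : ℕ}
  {Ω : Type*} {R : ℕ → Ω → ℝ} {μ : Policy K} {y₀ : ℝ}

/-! ### Trajectories of admissible policies -/

lemma demand_mem (hμ : M.Admissible μ) (hy₀ : 0 ≤ y₀) (ht : t ≤ M.T) (ω : Ω) :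
    demand R μ y₀ t ω ∈ Icc 0 y₀ := by
  induction t with
  | zero => exact ⟨hy₀, le_rfl⟩
  | succ t ih =>
    obtain ⟨h0, h1⟩ := ih (Nat.le_of_succ_le ht)
    have hv := (hμ.2 t ht _ h0 (R t ω)).1
    have hv' := hv.2.trans (min_le_right _ _)
    exact ⟨sub_nonneg.2 hv', (sub_le_self _ hv.1).trans h1⟩

lemma decision_mem_feasible (hμ : M.Admissible μ) (hy₀ : 0 ≤ y₀) (ht : t < M.T) (ω : Ω) :
    μ t (demand R μ y₀ t ω) (R t ω) ∈ M.feasible (demand R μ y₀ t ω) :=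
  hμ.2 t ht _ (demand_mem hμ hy₀ ht.le ω).1 _

/-- Only stages strictly before `t` enter; this is what makes the demand independent of `R t`. -/
lemma measurable_demand_past (hμ : M.Admissible μ) (y₀ : ℝ) (ht : t ≤ M.T) :
    Measurable[⨆ s ∈ Iio t, MeasurableSpace.comap (R s) inferInstance] (demand R μ y₀ t) := by
  induction t with
  | zero => exact @measurable_const _ _ _ (_) _
  | succ t ih =>
    set m := ⨆ s ∈ Iio (t + 1), MeasurableSpace.comap (R s) inferInstance with hm
    have hD : Measurable[m] (demand R μ y₀ t) :=
      (ih (Nat.le_of_succ_le ht)).mono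
        (biSup_mono fun s hs => lt_trans hs (Nat.lt_succ_self t)) le_rfl
    have hR : Measurable[m] (R t) := by
      refine (comap_measurable (R t)).mono ?_ le_rfl
      exact le_biSup (fun s => MeasurableSpace.comap (R s) inferInstance) (Nat.lt_succ_self t)
    exact hD.sub (measurable_fst.comp ((hμ.1 t ht).comp (hD.prodMk hR)))

variable [MeasurableSpace Ω] {P : Measure Ω}

lemma measurable_demand (hR : ∀ t, Measurable (R t)) (hμ : M.Admissible μ) (y₀ : ℝ)
    (ht : t ≤ M.T) : Measurable (demand R μ y₀ t) :=
  (measurable_demand_past hμ y₀ ht).mono (iSup₂_le fun s _ => (hR s).comap_le) le_rfl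

lemma indepFun_demand (hR : ∀ t, Measurable (R t)) (hRind : iIndepFun R P)
    (hμ : M.Admissible μ) (y₀ : ℝ) (ht : t ≤ M.T) : IndepFun (demand R μ y₀ t) (R t) P := by
  have h := indep_iSup_of_disjoint (fun s => (hR s).comap_le) hRind
    (show Disjoint (Iio t) {t} by simp)
  rw [iSup_singleton] at h
  exact indep_of_indep_of_le_left h (measurable_demand_past hμ y₀ ht).comap_le

lemma measurable_decision (hR : ∀ t, Measurable (R t)) (hμ : M.Admissible μ) (y₀ : ℝ)
    (ht : t < M.T) : Measurable fun ω => μ t (demand R μ y₀ t ω) (R t ω) :=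
  (hμ.1 t ht).comp ((measurable_demand hR hμ y₀ ht.le).prodMk (hR t))

/-- Outside `[a, b]` nothing is known about `f`, so measurability comes from its continuous
extension through the projection. -/
lemma integrable_comp_of_mem_Icc [IsFiniteMeasure P] {f : ℝ → ℝ} {X : Ω → ℝ} {a b : ℝ}
    (hab : a ≤ b) (hf : ContinuousOn f (Icc a b)) (hX : Measurable X) (h : ∀ ω, X ω ∈ Icc a b) :
    Integrable (fun ω => f (X ω)) P := by
  obtain ⟨B, hB⟩ := isCompact_Icc.exists_bound_of_continuousOn hf
  have hext : Continuous fun x => f (projIcc a b hab x) :=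
    hf.comp_continuous (by fun_prop) fun x => (projIcc a b hab x).2
  have hmeas : Measurable fun ω => f (X ω) := by
    convert hext.measurable.comp hX using 2 with ω
    simp only [Function.comp_apply, projIcc_of_mem hab (h ω)]
  exact Integrable.of_bound hmeas.aestronglyMeasurable B (.of_forall fun ω => hB _ (h ω))

lemma integrable_stageReward [IsProbabilityMeasure P] (hM : M.Regular) (hA : M.PriceAssumption)
    (hR : ∀ t, Measurable (R t)) (hRint : ∀ t, Integrable (R t) P) (hμ : M.Admissible μ)
    (hy₀ : 0 ≤ y₀) (ht : t < M.T) :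
    Integrable (fun ω => M.stageReward t (R t ω) (μ t (demand R μ y₀ t ω) (R t ω))) P := by
  have hmeas := measurable_decision hR hμ y₀ ht
  have hfeas := fun ω => decision_mem_feasible (R := R) hμ hy₀ ht ω
  set u := fun ω => μ t (demand R μ y₀ t ω) (R t ω)
  have hd : ∀ i, Measurable fun ω => (u ω).2 i := fun i =>
    (measurable_pi_apply i).comp hmeas.snd
  have hU : ∀ i, Integrable (fun ω => M.U t i ((u ω).2 i)) P := fun i =>
    integrable_comp_of_mem_Icc (hM.dbar_nonneg i) (hM.contDiffOn t ht i).continuousOn (hd i)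
      fun ω => (hfeas ω).2 i
  have hz : Integrable (fun ω => totalLoad (u ω) - R t ω) P :=
    ((integrable_comp_of_mem_Icc hM.vbar_nonneg continuousOn_id hmeas.fst fun ω =>
      ⟨(hfeas ω).1.1, (hfeas ω).1.2.trans (min_le_left _ _)⟩).add
      (integrable_finsetSum _ fun i _ => integrable_comp_of_mem_Icc (hM.dbar_nonneg i)
        continuousOn_id (hd i) fun ω => (hfeas ω).2 i)).sub
      (hRint t)
  have hp : Integrable (fun ω => M.payment t (totalLoad (u ω) - R t ω)) P := by
    refine (hz.norm.const_mul (|M.πp t| + |M.πm t|)).mono'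
      (continuous_payment.comp_aestronglyMeasurable hz.1) (.of_forall fun ω => ?_)
    simpa [payment] using payment_lipschitz (hA t ht).1 (totalLoad (u ω) - R t ω) 0
  exact (integrable_finsetSum _ fun i _ => hU i).sub hp

lemma integrable_demand [IsProbabilityMeasure P] (hR : ∀ t, Measurable (R t))
    (hμ : M.Admissible μ) (hy₀ : 0 ≤ y₀) (ht : t ≤ M.T) :
    Integrable (demand R μ y₀ t) P :=
  integrable_comp_of_mem_Icc hy₀ continuousOn_id (measurable_demand hR hμ y₀ ht)
    (demand_mem hμ hy₀ ht)

lemma integrable_totalReward [IsProbabilityMeasure P] (hM : M.Regular) (hA : M.PriceAssumption)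
    (hR : ∀ t, Measurable (R t)) (hRint : ∀ t, Integrable (R t) P) (hμ : M.Admissible μ)
    (hy₀ : 0 ≤ y₀) : Integrable (M.totalReward R μ y₀) P :=
  (integrable_finsetSum _ fun _ ht =>
    integrable_stageReward hM hA hR hRint hμ hy₀ (Finset.mem_range.1 ht)).sub
    ((integrable_demand hR hμ hy₀ le_rfl).const_mul _)

/-! ### Verification -/

lemma integrable_expectedValue_demand [IsProbabilityMeasure P] (hR : ∀ t, Measurable (R t))
    (hV : RegularValue M P R t) (hμ : M.Admissible μ) (hy₀ : 0 ≤ y₀) (ht : t ≤ M.T) :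
    Integrable (fun ω => M.expectedValue P R t (demand R μ y₀ t ω)) P :=
  integrable_comp_of_mem_Icc hy₀ (hV.continuousOn.mono fun _ hy => hy.1)
    (measurable_demand hR hμ y₀ ht) (demand_mem hμ hy₀ ht)

/-- The demand at stage `t` is independent of the renewable generation at stage `t`, so the latter
can be integrated out. -/
lemma integral_value_demand [IsProbabilityMeasure P] (hM : M.Regular) (hA : M.PriceAssumption)
    (hR : ∀ t, Measurable (R t)) (hRint : ∀ t, Integrable (R t) P) (hRind : iIndepFun R P)
    (hμ : M.Admissible μ) (hy₀ : 0 ≤ y₀) (ht : t < M.T) :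
    Integrable (fun ω => M.value P R t (demand R μ y₀ t ω) (R t ω)) P ∧
    ∫ ω, M.value P R t (demand R μ y₀ t ω) (R t ω) ∂P =
      ∫ ω, M.expectedValue P R t (demand R μ y₀ t ω) ∂P := by
  obtain ⟨C, hC, hl⟩ := value_lipschitz hM hA ht (regularValue hM hA hRint ht)
  have hD := measurable_demand hR hμ y₀ ht.le
  have hD0 := fun ω => demand_mem (R := R) hμ hy₀ ht.le ω
  -- The Lipschitz bound covers only `y ≥ 0`. Truncation makes the value function jointly continuous
  -- and changes nothing along trajectories.
  set f : ℝ × ℝ → ℝ := fun p => M.value P R t (max p.1 0) p.2 with hf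
  have hfc : Continuous f := by
    refine LipschitzWith.continuous (K := (2 * C).toNNReal)
      (LipschitzWith.of_dist_le_mul fun p q => ?_)
    have h₁ := hl (max p.1 0) (le_max_right _ _) (max q.1 0) (le_max_right _ _) p.2 q.2
    have h₂ : |max p.1 0 - max q.1 0| ≤ |p.1 - q.1| := abs_max_sub_max_le_abs _ _ _
    have h₃ : |p.1 - q.1| ≤ dist p q := le_max_left _ _
    have h₄ : |p.2 - q.2| ≤ dist p q := le_max_right _ _
    rw [Real.coe_toNNReal _ (by positivity), Real.dist_eq]
    calc _ ≤ C * (|max p.1 0 - max q.1 0| + |p.2 - q.2|) := h₁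
      _ ≤ C * (dist p q + dist p q) := by gcongr; exact h₂.trans h₃
      _ = 2 * C * dist p q := by ring
  have heq : (fun ω => M.value P R t (demand R μ y₀ t ω) (R t ω)) =
      fun ω => f (demand R μ y₀ t ω, R t ω) :=
    funext fun ω => by simp only [hf, max_eq_left (hD0 ω).1]
  have hint : Integrable (fun ω => f (demand R μ y₀ t ω, R t ω)) P := by
    refine (((integrable_demand hR hμ hy₀ ht.le).norm.add (hRint t).norm).const_mul C).add
      (integrable_const |M.value P R t 0 0|) |>.mono'
      (hfc.measurable.comp (hD.prodMk (hR t))).aestronglyMeasurable (.of_forall fun ω => ?_)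
    have h₁ := hl _ (hD0 ω).1 0 le_rfl (R t ω) 0
    have h₂ := abs_sub_abs_le_abs_sub (M.value P R t (demand R μ y₀ t ω) (R t ω))
      (M.value P R t 0 0)
    simp only [hf, max_eq_left (hD0 ω).1, Real.norm_eq_abs, Pi.add_apply, sub_zero] at h₁ ⊢
    linarith
  refine ⟨heq ▸ hint, ?_⟩
  -- By independence the joint law is a product, so Fubini applies.
  have hmap := (indepFun_demand hR hRind hμ y₀ ht.le).map_prod_eq_prod_map_map
    hD.aemeasurable (hR t).aemeasurable
  have hint' : Integrable f ((P.map (demand R μ y₀ t)).prod (P.map (R t))) := by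
    rw [← hmap]
    exact (integrable_map_measure hfc.aestronglyMeasurable
      (hD.prodMk (hR t)).aemeasurable).2 hint
  have := Measure.isProbabilityMeasure_map (μ := P) (hR t).aemeasurable
  have := Measure.isProbabilityMeasure_map (μ := P) hD.aemeasurable
  rw [heq, ← integral_map (hD.prodMk (hR t)).aemeasurable hfc.aestronglyMeasurable, hmap,
    integral_prod f hint', integral_map hD.aemeasurable
      hfc.stronglyMeasurable.integral_prod_right.aestronglyMeasurable]
  refine integral_congr_ae (.of_forall fun ω => ?_)
  simp only
  rw [integral_map (hR t).aemeasurable (by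
    exact (hfc.comp (Continuous.prodMk_right _)).aestronglyMeasurable)]
  simp only [hf, max_eq_left (hD0 ω).1, expectedValue]

/-- The expected reward of a stage plus the expected optimal value after it is the expected Bellman
objective. -/
lemma integral_stageReward_add [IsProbabilityMeasure P] (hM : M.Regular) (hA : M.PriceAssumption)
    (hR : ∀ t, Measurable (R t)) (hRint : ∀ t, Integrable (R t) P)
    (hμ : M.Admissible μ) (hy₀ : 0 ≤ y₀) (ht : t < M.T) :
    Integrable (fun ω => M.bellmanObjective P R t (demand R μ y₀ t ω) (R t ω)
      (μ t (demand R μ y₀ t ω) (R t ω))) P ∧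
    ∫ ω, M.stageReward t (R t ω) (μ t (demand R μ y₀ t ω) (R t ω)) ∂P +
      ∫ ω, M.expectedValue P R (t + 1) (demand R μ y₀ (t + 1) ω) ∂P =
    ∫ ω, M.bellmanObjective P R t (demand R μ y₀ t ω) (R t ω)
      (μ t (demand R μ y₀ t ω) (R t ω)) ∂P := by
  have h₁ := integrable_stageReward hM hA hR hRint hμ hy₀ ht
  have h₂ := integrable_expectedValue_demand hR (regularValue hM hA hRint ht) hμ hy₀ ht
  exact ⟨h₁.add h₂, (integral_add h₁ h₂).symm⟩

lemma integral_totalReward [IsProbabilityMeasure P] (hM : M.Regular) (hA : M.PriceAssumption)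
    (hR : ∀ t, Measurable (R t)) (hRint : ∀ t, Integrable (R t) P) (hμ : M.Admissible μ)
    (hy₀ : 0 ≤ y₀) :
    ∫ ω, M.totalReward R μ y₀ ω ∂P =
      (∑ t ∈ Finset.range M.T,
        ∫ ω, M.stageReward t (R t ω) (μ t (demand R μ y₀ t ω) (R t ω)) ∂P) +
      ∫ ω, M.expectedValue P R M.T (demand R μ y₀ M.T ω) ∂P := by
  have h : ∀ t ∈ Finset.range M.T, Integrable
      (fun ω => M.stageReward t (R t ω) (μ t (demand R μ y₀ t ω) (R t ω))) P := fun t ht =>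
    integrable_stageReward hM hA hR hRint hμ hy₀ (Finset.mem_range.1 ht)
  unfold totalReward
  rw [integral_sub (integrable_finsetSum _ h)
    ((integrable_demand hR hμ hy₀ le_rfl).const_mul _), integral_finsetSum _ h]
  simp only [expectedValue_terminal, neg_mul, integral_neg, sub_eq_add_neg]

lemma integral_totalReward_le [IsProbabilityMeasure P] (hM : M.Regular) (hA : M.PriceAssumption)
    (hR : ∀ t, Measurable (R t)) (hRint : ∀ t, Integrable (R t) P) (hRind : iIndepFun R P)
    (hμ : M.Admissible μ) (hy₀ : 0 ≤ y₀) :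
    ∫ ω, M.totalReward R μ y₀ ω ∂P ≤ M.expectedValue P R 0 y₀ := by
  -- Expected reward collected before `n` plus expected optimal value from `n` on cannot increase
  -- with `n`: it starts at the optimal value and ends at the expected total reward.
  have key : ∀ n ≤ M.T, (∑ t ∈ Finset.range n,
      ∫ ω, M.stageReward t (R t ω) (μ t (demand R μ y₀ t ω) (R t ω)) ∂P) +
      ∫ ω, M.expectedValue P R n (demand R μ y₀ n ω) ∂P ≤ M.expectedValue P R 0 y₀ := by
    intro n hn
    induction n with
    | zero => simp [demand]
    | succ n ih =>
      obtain ⟨h₁, h₂⟩ := integral_stageReward_add hM hA hR hRint hμ hy₀ hn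
      obtain ⟨h₃, h₄⟩ := integral_value_demand hM hA hR hRint hRind hμ hy₀ hn
      have hle := integral_mono h₁ h₃ fun ω => bellmanObjective_le_value hM hn
        (regularValue hM hA hRint hn) (decision_mem_feasible hμ hy₀ hn ω)
      rw [Finset.sum_range_succ]
      linarith [ih (Nat.le_of_succ_le hn)]
  rw [integral_totalReward hM hA hR hRint hμ hy₀]
  exact key M.T le_rfl

lemma integral_totalReward_eq [IsProbabilityMeasure P] (hM : M.Regular) (hA : M.PriceAssumption)
    (hR : ∀ t, Measurable (R t)) (hRint : ∀ t, Integrable (R t) P) (hRind : iIndepFun R P)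
    (hμ : M.Admissible μ) (hy₀ : 0 ≤ y₀)
    (hopt : ∀ t < M.T, ∀ y, 0 ≤ y → ∀ r, M.IsOptimalDecision P R t y r (μ t y r)) :
    ∫ ω, M.totalReward R μ y₀ ω ∂P = M.expectedValue P R 0 y₀ := by
  -- Under optimal decisions the same quantity is constant in `n`.
  have key : ∀ n ≤ M.T, (∑ t ∈ Finset.range n,
      ∫ ω, M.stageReward t (R t ω) (μ t (demand R μ y₀ t ω) (R t ω)) ∂P) +
      ∫ ω, M.expectedValue P R n (demand R μ y₀ n ω) ∂P = M.expectedValue P R 0 y₀ := by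
    intro n hn
    induction n with
    | zero => simp [demand]
    | succ n ih =>
      have h₂ := (integral_stageReward_add hM hA hR hRint hμ hy₀ hn).2
      have h₄ := (integral_value_demand hM hA hR hRint hRind hμ hy₀ hn).2
      simp only [← (hopt n hn _ (demand_mem hμ hy₀ (Nat.le_of_succ_le hn) _).1 _).value_eq hn]
        at h₂
      rw [Finset.sum_range_succ]
      linarith [ih (Nat.le_of_succ_le hn)]
  rw [integral_totalReward hM hA hR hRint hμ hy₀]
  exact key M.T le_rfl

end Prosumer

/-! ### Threshold structure and optimality -/

theorem theorem1 {K : ℕ} (M : Prosumer K) (hM : M.Regular) (hA : M.PriceAssumption)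
    {Ω : Type*} [MeasurableSpace Ω] (P : Measure Ω) [IsProbabilityMeasure P]
    (R : ℕ → Ω → ℝ) (hR : ∀ t, Measurable (R t)) (hRint : ∀ t, Integrable (R t) P)
    (hRind : iIndepFun R P) :
    -- the expectations that occur are finite
    (∀ t ≤ M.T, ∀ y, 0 ≤ y → Integrable (fun ω => M.value P R t y (R t ω)) P) ∧
    (∀ μ, M.Admissible μ → ∀ y₀, 0 ≤ y₀ → Integrable (M.totalReward R μ y₀) P) ∧
    -- thresholds exist
    (∃ τ δ : ℕ → ℝ, M.IsThresholds P R τ δ ∧ ∀ t < M.T, δ t ≤ τ t ∧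
      τ t ∈ Icc 0 (((M.T : ℝ) - t - 1) * M.vbar) ∧
      δ t ∈ Icc 0 (((M.T : ℝ) - t - 1) * M.vbar)) ∧
    -- and any thresholds describe an optimal policy
    ∀ τ δ : ℕ → ℝ, M.IsThresholds P R τ δ →
      -- the three zones partition the renewable axis
      (∀ t < M.T, ∀ y, 0 ≤ y → M.renewableThreshold t (M.πp t) (τ t) y ≤
        M.renewableThreshold t (M.πm t) (δ t) y) ∧
      -- there is an admissible policy with the threshold structure
      (∃ μ, M.Admissible μ ∧ M.HasThresholdStructure P R τ δ μ) ∧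
      ∀ μ, M.HasThresholdStructure P R τ δ μ →
        -- its decisions are optimal in every state, and its consumption is the only optimal one
        (∀ t < M.T, ∀ y, 0 ≤ y → ∀ r, M.IsOptimalDecision P R t y r (μ t y r) ∧
          ∀ u, M.IsOptimalDecision P R t y r u → u.2 = (μ t y r).2) ∧
        -- it solves the stochastic dynamic program, with the value function as its value
        (M.Admissible μ → M.IsOptimalPolicy P R μ ∧ ∀ y₀, 0 ≤ y₀ →
          ∫ ω, M.totalReward R μ y₀ ω ∂P = M.expectedValue P R 0 y₀) ∧
        -- its decisions in the net-zero zone increase with the renewable generation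
        (∀ t < M.T, ∀ y, 0 ≤ y →
          MonotoneOn (fun r => (μ t y r).1)
            (Icc (M.renewableThreshold t (M.πp t) (τ t) y)
              (M.renewableThreshold t (M.πm t) (δ t) y)) ∧
          ∀ i, MonotoneOn (fun r => (μ t y r).2 i)
            (Icc (M.renewableThreshold t (M.πp t) (τ t) y)
              (M.renewableThreshold t (M.πm t) (δ t) y))) := by
  have hV : ∀ t ≤ M.T, M.RegularValue P R t := fun t ht => Prosumer.regularValue hM hA hRint ht
  refine ⟨fun t ht y hy => Prosumer.integrable_value hM hA hRint ht hy,
    fun μ hμ y₀ hy₀ => Prosumer.integrable_totalReward hM hA hR hRint hμ hy₀,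
    Prosumer.exists_isThresholds hM hA hV, fun τ δ hth => ⟨fun t ht y _ =>
      Prosumer.renewableThreshold_le hM ht (hA t ht).1 (hth.le hA ht) y,
    Prosumer.exists_threshold_policy hM hA hV hth, fun μ hμ => ?_⟩⟩
  have hopt : ∀ t < M.T, ∀ y, 0 ≤ y → ∀ r, M.IsOptimalDecision P R t y r (μ t y r) ∧
      ∀ u, M.IsOptimalDecision P R t y r u → u.2 = (μ t y r).2 :=
    fun t ht y hy r => hμ.isOptimal hM hA hV hth ht hy r
  refine ⟨hopt, fun hadm => ?_, fun t ht y hy => ?_⟩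
  · have hval : ∀ y₀, 0 ≤ y₀ → ∫ ω, M.totalReward R μ y₀ ω ∂P = M.expectedValue P R 0 y₀ :=
      fun y₀ hy₀ => Prosumer.integral_totalReward_eq hM hA hR hRint hRind hadm hy₀
        fun t ht y hy r => (hopt t ht y hy r).1
    refine ⟨⟨hadm, fun y₀ hy₀ μ' hμ' => ?_⟩, hval⟩
    rw [hval y₀ hy₀]
    exact Prosumer.integral_totalReward_le hM hA hR hRint hRind hμ' hy₀
  · have hmono : ∀ r₁ ∈ Icc (M.renewableThreshold t (M.πp t) (τ t) y)
          (M.renewableThreshold t (M.πm t) (δ t) y),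
        ∀ r₂ ∈ Icc (M.renewableThreshold t (M.πp t) (τ t) y)
          (M.renewableThreshold t (M.πm t) (δ t) y), r₁ ≤ r₂ → μ t y r₁ ≤ μ t y r₂ :=
      fun r₁ h₁ r₂ h₂ h => Prosumer.NetZeroRule.mono hM ht
        ((hμ t ht y hy r₁).2.2 h₁) ((hμ t ht y hy r₂).2.2 h₂) h
    exact ⟨fun r₁ h₁ r₂ h₂ h => (hmono r₁ h₁ r₂ h₂ h).1,
      fun i r₁ h₁ r₂ h₂ h => (hmono r₁ h₁ r₂ h₂ h).2 i⟩
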